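/- Let $f:\mathbb C\to\mathbb C$ be entire, let $R>0$, and let $U$ be a connected component of $A_R=\{z\in\mathbb C:|f(z)|>R\}$ such that $\{z:|z|=r\}\not\subset U$ for all sufficiently large $r$. Let $0<\beta<\tfrac12$ and put $$V=\{z\in U:|f(z)|\ge \exp(|z|^\beta)\},\qquad \psi(r)=\operatorname{meas}\{t\in[0,2\pi]: re^{it}\in V\},$$ where $\operatorname{meas}$ is Lebesgue measure, and let $M(r,f)=\max_{|z|=r}|f(z)|$. Then for every $0<\kappa<1$ there exist constants $C\in\mathbb R$ and $r_0>0$ such that $\psi(t)>0$ for all $t\ge r_0$ and, for all $r\ge r_0/\kappa$, we have $M(r,f)>1$, the function $t\mapsto 1/(t\psi(t))$ is integrable on $[r_0,\kappa r]$, and $$\log\log M(r,f)\ \ge\ \pi\int_{r_0}^{\kappa r}\frac{dt}{t\,\psi(t)}-C .$$ -/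

import Mathlib

open MeasureTheory Filter

noncomputable section

/-- The maximum modulus `M(r,f) = max_{|z|=r} |f(z)|`. -/
def maxModulus (f : ℂ → ℂ) (r : ℝ) : ℝ :=
  sSup ((fun z => ‖f z‖) '' Metric.sphere (0 : ℂ) r)

/-- The set `A_R = {z ∈ ℂ : |f(z)| > R}`. -/
def superlevel (f : ℂ → ℂ) (R : ℝ) : Set ℂ :=
  {z | R < ‖f z‖}

/-- `U` is a connected component of the subset `A` of the plane (in particular `U` is nonempty). -/
def IsComponentOf (U A : Set ℂ) : Prop :=
  ∃ z ∈ A, U = connectedComponentIn A z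

/-- The set `V = {z ∈ U : |f(z)| ≥ exp(|z|^β)}`. -/
def growthSet (f : ℂ → ℂ) (U : Set ℂ) (β : ℝ) : Set ℂ :=
  {z ∈ U | Real.exp (‖z‖ ^ β) ≤ ‖f z‖}

/-- The angular measure `meas {t ∈ [0,2π] : r e^{it} ∈ V}` of `V` on the circle `|z| = r`. -/
def angularMeasure (V : Set ℂ) (r : ℝ) : ℝ :=
  volume.real {t : ℝ | t ∈ Set.Icc 0 (2 * Real.pi) ∧ (r : ℂ) * Complex.exp (t * Complex.I) ∈ V}

end

/-! ### A Wirtinger inequality governed by the measure of the support -/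

/-! This is Carleman's method in the coordinates `s = log|z|`, `t = arg z`. Let `w` be a smoothed
positive part of `log|f| - |z|^β - K` on `U`, extended by zero. On `U` the function `log|f|` is
harmonic, and near the complement of `U` it is below `K`; so `w` is `C²` on the cylinder, its
Laplacian is at least `-β² e^{βs}`, and for `K ≥ 0` its support on the circle of radius `e^s` lies
in `V`.

Put `J(s) = ∫ w² dt`. Integration by parts gives `J'' ≥ 2∫ w_s² + 2∫ w_t² - 2β² e^{βs} ∫ w`. Large
circles leave `U`, so `w` has a zero on them, and `wirtinger_periodic` yields `∫ w_t² ≥ (π/ψ)² J`: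
the measure of the support replaces the length of an interval, however many arcs there are. Since
`2p J' ≤ 2∫ w_s² + 2p² J`, this would give `J'' ≥ 2(π/ψ) J'` if the error term were absent.

The error is controlled by an a priori bound `J ≥ a e^s`. Without the term `|z|^β` the Laplacian is
nonnegative, and the trivial bound `2π` for the support gives `J'' ≥ J'`, hence growth like `e^s`.
Restoring `|z|^β` changes the mean by `O(e^{2βs})`, which is negligible exactly because `β < 1/2`.
The error then lowers `π/ψ` only by `A e^{-(1/2-β)s}`, which is integrable
(`exists_squareMean_inequality`).

Integrating `(log J')' ≥ 2π/ψ - 2A e^{-(1/2-β)s}` bounds `log J'` below at `log(κr)`. Convexity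
passes from `J'` at `log(κr)` to `J` at `log r`, which is where `κ < 1` is needed, and `J ≤ 2π (log
M)²` finishes. -/

theorem HasDerivAt.mul_of_eq_zero {h B : ℝ → ℝ} {h' t : ℝ} (hd : HasDerivAt h h' t)
    (h0 : h t = 0) (hB : ContinuousAt B t) : HasDerivAt (fun x => h x * B x) (h' * B t) t := by
  rw [hasDerivAt_iff_tendsto_slope] at hd ⊢
  have := hd.mul (hB.tendsto.mono_left (nhdsWithin_le_nhds (s := {t}ᶜ)))
  refine this.congr fun x => ?_
  simp only [slope_def_field, h0]
  ring

theorem hasDerivAt_cot_comp {θ : ℝ → ℝ} {k t : ℝ} (hθ : HasDerivAt θ k t)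
    (hs : Real.sin (θ t) ≠ 0) :
    HasDerivAt (fun x => Real.cos (θ x) / Real.sin (θ x))
      (-k * (1 + (Real.cos (θ t) / Real.sin (θ t)) ^ 2)) t := by
  refine (hθ.cos.div hθ.sin hs).congr_deriv ?_
  field_simp
  ring

/-- The length of the part of `[a, t]` on which `h` does not vanish. -/
noncomputable def supportLength (h : ℝ → ℝ) (a t : ℝ) : ℝ :=
  ∫ x in a..t, Set.indicator {x | h x ≠ 0} (fun _ => (1 : ℝ)) x

section supportLength

variable {h : ℝ → ℝ} (hc : Continuous h)

include hc

theorem measurableSet_ne_zero : MeasurableSet {x | h x ≠ 0} :=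
  (isOpen_ne_fun hc continuous_const).measurableSet

theorem intervalIntegrable_indicator_ne_zero (a b : ℝ) :
    IntervalIntegrable (Set.indicator {x | h x ≠ 0} (fun _ => (1 : ℝ))) volume a b := by
  have h1 : IntervalIntegrable (fun _ => (1 : ℝ)) volume a b := intervalIntegrable_const
  exact ⟨h1.1.indicator (measurableSet_ne_zero hc), h1.2.indicator (measurableSet_ne_zero hc)⟩

theorem continuous_supportLength (a : ℝ) : Continuous (supportLength h a) :=
  intervalIntegral.continuous_primitive (intervalIntegrable_indicator_ne_zero hc) a

theorem hasDerivAt_supportLength (a : ℝ) {t : ℝ} (ht : h t ≠ 0) :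
    HasDerivAt (supportLength h a) 1 t := by
  have hev : ∀ᶠ x in nhds t, Set.indicator {x | h x ≠ 0} (fun _ => (1 : ℝ)) x = 1 := by
    filter_upwards [(isOpen_ne_fun hc continuous_const).mem_nhds ht] with x hx
    exact Set.indicator_of_mem hx _
  have hcont : ContinuousAt (Set.indicator {x | h x ≠ 0} (fun _ => (1 : ℝ))) t :=
    (continuousAt_const (y := (1 : ℝ))).congr (hev.mono fun x hx => hx.symm)
  have := intervalIntegral.integral_hasDerivAt_right
    (intervalIntegrable_indicator_ne_zero hc a t)
    ((measurable_const.indicator (measurableSet_ne_zero hc)).stronglyMeasurable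
      |>.stronglyMeasurableAtFilter) hcont
  rwa [hev.self_of_nhds] at this

theorem supportLength_mono (a : ℝ) : Monotone (supportLength h a) := by
  intro s t hst
  have := intervalIntegral.integral_add_adjacent_intervals
    (intervalIntegrable_indicator_ne_zero hc a s) (intervalIntegrable_indicator_ne_zero hc s t)
  have h2 : 0 ≤ ∫ x in s..t, Set.indicator {x | h x ≠ 0} (fun _ => (1 : ℝ)) x :=
    intervalIntegral.integral_nonneg hst fun x _ => Set.indicator_nonneg (by simp) x
  unfold supportLength
  linarith

end supportLength

/-- With `ℓ` the support length and `B = cot(kℓ + ε)`, the function `k h² B` vanishes at both ends,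
so its derivative has integral zero. Adding that derivative to `k² h²` gives `2k h h' B - k² h² B²`,
which is at most `h'²` by completing the square. -/
theorem wirtinger_aux {h h' : ℝ → ℝ} (hd : ∀ t, HasDerivAt h (h' t) t) (hc' : Continuous h')
    {a b : ℝ} (hab : a ≤ b) (ha : h a = 0) (hb : h b = 0) {k : ℝ} (hk : 0 < k)
    (hkm : k * supportLength h a b < Real.pi) :
    k ^ 2 * ∫ t in a..b, h t ^ 2 ≤ ∫ t in a..b, h' t ^ 2 := by
  have hc : Continuous h := continuous_iff_continuousAt.2 fun t => (hd t).continuousAt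
  set m := supportLength h a b
  -- This shift keeps `θ` in `[ε, π - ε]`, away from the poles of the cotangent.
  set ε := (Real.pi - k * m) / 2 with hε
  have hε0 : 0 < ε := by linarith
  set θ : ℝ → ℝ := fun t => k * supportLength h a t + ε with hθ
  have hθc : Continuous θ := by
    have := continuous_supportLength hc a
    fun_prop
  have hsin : ∀ t ∈ Set.Icc a b, 0 < Real.sin (θ t) := by
    intro t ht
    have h0 : 0 ≤ supportLength h a t := by
      have := supportLength_mono hc a ht.1
      simpa [supportLength] using this
    have h1 : supportLength h a t ≤ m := supportLength_mono hc a ht.2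
    have h2 := mul_le_mul_of_nonneg_left h1 hk.le
    have h3 := mul_nonneg hk.le h0
    exact Real.sin_pos_of_pos_of_lt_pi (by simp only [hθ]; linarith) (by simp only [hθ]; linarith)
  set B : ℝ → ℝ := fun t => Real.cos (θ t) / Real.sin (θ t) with hB
  have hBc : ContinuousOn B (Set.Icc a b) :=
    (Real.continuous_cos.comp hθc).continuousOn.div (Real.continuous_sin.comp hθc).continuousOn
      fun t ht => (hsin t ht).ne'
  set A' : ℝ → ℝ := fun t => 2 * k * h t * h' t * B t - k ^ 2 * h t ^ 2 * (1 + B t ^ 2) with hA'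
  have hA'c : ContinuousOn A' (Set.Icc a b) := by
    have := hc.continuousOn (s := Set.Icc a b)
    have := hc'.continuousOn (s := Set.Icc a b)
    fun_prop
  have hderiv : ∀ t ∈ Set.Icc a b, HasDerivAt (fun x => h x * (h x * (k * B x))) (A' t) t := by
    intro t ht
    -- At a zero of `h`, `supportLength` may fail to be differentiable, but a vanishing factor only
    -- needs a continuous cofactor, and the derivative is then zero.
    by_cases h0 : h t = 0
    · have hBt : ContinuousAt B t :=
        (Real.continuous_cos.comp hθc).continuousAt.div (Real.continuous_sin.comp hθc).continuousAt
          (hsin t ht).ne'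
      have := (hd t).mul_of_eq_zero (B := fun x => h x * (k * B x)) h0
        (by have := hc.continuousAt (x := t); fun_prop)
      refine this.congr_deriv ?_
      simp [hA', h0]
    · have hθd : HasDerivAt θ k t := by
        exact (((hasDerivAt_supportLength hc a h0).const_mul k).add_const ε).congr_deriv (mul_one k)
      have hBd := hasDerivAt_cot_comp hθd (hsin t ht).ne'
      refine ((hd t).mul ((hd t).mul (hBd.const_mul k))).congr_deriv ?_
      simp only [hA', hB, Pi.mul_apply]
      ring
  have hInt : IntervalIntegrable A' volume a b := by
    apply ContinuousOn.intervalIntegrable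
    rwa [Set.uIcc_of_le hab]
  have hFTC : ∫ t in a..b, A' t = 0 := by
    rw [intervalIntegral.integral_eq_sub_of_hasDerivAt
      (fun t ht => hderiv t (by rwa [Set.uIcc_of_le hab] at ht)) hInt]
    simp [ha, hb]
  have i1 : IntervalIntegrable (fun t => h t ^ 2) volume a b := (hc.pow 2).intervalIntegrable _ _
  have i2 : IntervalIntegrable (fun t => h' t ^ 2) volume a b := (hc'.pow 2).intervalIntegrable _ _
  have key : ∫ t in a..b, (k ^ 2 * h t ^ 2 + A' t) ≤ ∫ t in a..b, h' t ^ 2 := by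
    refine intervalIntegral.integral_mono_on hab ((i1.const_mul _).add hInt) i2 fun t _ => ?_
    simp only [hA']
    nlinarith [sq_nonneg (h' t - k * h t * B t)]
  rwa [intervalIntegral.integral_add (i1.const_mul _) hInt, hFTC, add_zero,
    intervalIntegral.integral_const_mul] at key

/-- Wirtinger's inequality for a function vanishing at the end points of an interval, with the
length of the interval replaced by a bound for the measure of the support. -/
theorem wirtinger_of_supportLength_le {h h' : ℝ → ℝ} (hd : ∀ t, HasDerivAt h (h' t) t)
    (hc' : Continuous h') {a b : ℝ} (hab : a ≤ b) (ha : h a = 0) (hb : h b = 0) {m : ℝ}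
    (hm : 0 < m) (hle : supportLength h a b ≤ m) :
    (Real.pi / m) ^ 2 * ∫ t in a..b, h t ^ 2 ≤ ∫ t in a..b, h' t ^ 2 := by
  have hpi : 0 < Real.pi / m := div_pos Real.pi_pos hm
  -- `wirtinger_aux` needs the strict inequality `k ℓ < π`; the sharp constant comes from letting
  -- `k` increase to `π/m`.
  have htend : Tendsto (fun k : ℝ => k ^ 2 * ∫ t in a..b, h t ^ 2) (nhdsWithin (Real.pi / m)
      (Set.Iio (Real.pi / m))) (nhds ((Real.pi / m) ^ 2 * ∫ t in a..b, h t ^ 2)) :=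
    ((by fun_prop : Continuous fun k : ℝ => k ^ 2 * ∫ t in a..b, h t ^ 2).tendsto _).mono_left
      nhdsWithin_le_nhds
  refine le_of_tendsto htend ?_
  filter_upwards [self_mem_nhdsWithin, mem_nhdsWithin_of_mem_nhds (Ioi_mem_nhds hpi)] with k hk hk0
  refine wirtinger_aux hd hc' hab ha hb hk0 ?_
  calc k * supportLength h a b ≤ k * m := mul_le_mul_of_nonneg_left hle (le_of_lt hk0)
    _ < Real.pi := by rwa [Set.mem_Iio, lt_div_iff₀ hm] at hk

/-- The periodic form: the support is measured on one fixed period. -/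
theorem wirtinger_periodic {h h' : ℝ → ℝ} (hd : ∀ t, HasDerivAt h (h' t) t)
    (hc' : Continuous h') {T : ℝ} (hT : 0 ≤ T) (hp : Function.Periodic h T)
    (hp' : Function.Periodic h' T) {a : ℝ} (ha : h a = 0) {m : ℝ}
    (hm : 0 < m) (hle : supportLength h 0 T ≤ m) :
    (Real.pi / m) ^ 2 * ∫ t in 0..T, h t ^ 2 ≤ ∫ t in 0..T, h' t ^ 2 := by
  -- Periodicity moves the period so that it begins and ends at the zero `a`.
  have e : ∀ {g : ℝ → ℝ}, Function.Periodic g T → ∫ t in 0..T, g t = ∫ t in a..(a + T), g t := by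
    intro g hg
    simpa using hg.intervalIntegral_add_eq 0 a
  have p1 : Function.Periodic (fun t => h t ^ 2) T := fun t => by simp only [hp t]
  have p2 : Function.Periodic (fun t => h' t ^ 2) T := fun t => by simp only [hp' t]
  have p3 : Function.Periodic (Set.indicator {x | h x ≠ 0} (fun _ => (1 : ℝ))) T := fun t => by
    simp only [Set.indicator, Set.mem_ofPred_eq, hp t]
  rw [e p1, e p2]
  refine wirtinger_of_supportLength_le hd hc' (by linarith) ha (by rw [hp a, ha]) hm ?_
  have := e p3
  unfold supportLength at hle ⊢
  linarith

/-! ### A convex smoothing of the positive part -/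

/-- A `C²` convex function vanishing on `(-∞, 0]`, with slope at most one, that differs from the
identity on `[0, ∞)` by at most one. -/
noncomputable def smoothPos (x : ℝ) : ℝ := ∫ t in (0 : ℝ)..x, Real.smoothTransition t

theorem hasDerivAt_smoothPos (x : ℝ) : HasDerivAt smoothPos (Real.smoothTransition x) x :=
  intervalIntegral.integral_hasDerivAt_right (Real.smoothTransition.continuous.intervalIntegrable _ _)
    Real.smoothTransition.continuous.stronglyMeasurable.stronglyMeasurableAtFilter
    Real.smoothTransition.continuousAt

theorem hasDerivAt_smoothTransition (x : ℝ) :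
    HasDerivAt Real.smoothTransition (deriv Real.smoothTransition x) x :=
  ((Real.smoothTransition.contDiff (n := 1)).differentiable (by simp) x).hasDerivAt

theorem continuous_deriv_smoothTransition : Continuous (deriv Real.smoothTransition) :=
  (Real.smoothTransition.contDiff (n := 1)).continuous_deriv (by simp)

theorem deriv_smoothTransition_nonneg (x : ℝ) : 0 ≤ deriv Real.smoothTransition x :=
  Real.smoothTransition.monotone.deriv_nonneg

theorem continuous_smoothPos : Continuous smoothPos :=
  continuous_iff_continuousAt.2 fun x => (hasDerivAt_smoothPos x).continuousAt

theorem smoothPos_of_nonpos {x : ℝ} (hx : x ≤ 0) : smoothPos x = 0 := by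
  unfold smoothPos
  rw [intervalIntegral.integral_congr (g := fun _ => (0 : ℝ))]
  · simp
  · intro t ht
    rw [Set.uIcc_of_ge hx] at ht
    exact Real.smoothTransition.zero_of_nonpos ht.2

theorem smoothPos_monotone : Monotone smoothPos :=
  monotone_of_deriv_nonneg (fun x => (hasDerivAt_smoothPos x).differentiableAt) fun x => by
    rw [(hasDerivAt_smoothPos x).deriv]; exact Real.smoothTransition.nonneg x

theorem smoothPos_nonneg (x : ℝ) : 0 ≤ smoothPos x := by
  rcases le_total x 0 with hx | hx
  · rw [smoothPos_of_nonpos hx]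
  · simpa [smoothPos_of_nonpos le_rfl] using smoothPos_monotone hx

theorem smoothPos_le {x : ℝ} (hx : 0 ≤ x) : smoothPos x ≤ x := by
  have : Monotone fun y => y - smoothPos y :=
    monotone_of_deriv_nonneg
      (fun x => ((hasDerivAt_id' x).fun_sub (hasDerivAt_smoothPos x)).differentiableAt) fun x => by
      rw [((hasDerivAt_id' x).fun_sub (hasDerivAt_smoothPos x)).deriv]
      linarith [Real.smoothTransition.le_one x]
  have := this hx
  simp only [smoothPos_of_nonpos le_rfl] at this
  linarith

theorem sub_one_le_smoothPos (x : ℝ) : x - 1 ≤ smoothPos x := by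
  rcases le_total x 1 with hx | hx
  · linarith [smoothPos_nonneg x]
  · have h := intervalIntegral.integral_interval_sub_left
      (Real.smoothTransition.continuous.intervalIntegrable (μ := volume) 0 x)
      (Real.smoothTransition.continuous.intervalIntegrable (μ := volume) 0 1)
    have h2 : ∫ t in (1 : ℝ)..x, Real.smoothTransition t = ∫ t in (1 : ℝ)..x, (1 : ℝ) := by
      refine intervalIntegral.integral_congr fun t ht => ?_
      rw [Set.uIcc_of_le hx] at ht
      exact Real.smoothTransition.one_of_one_le ht.1
    rw [h2] at h
    simp at h
    have := smoothPos_nonneg 1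
    unfold smoothPos at *
    linarith

theorem smoothPos_pos {x : ℝ} (hx : 0 < x) : 0 < smoothPos x :=
  intervalIntegral.intervalIntegral_pos_of_pos_on
    (Real.smoothTransition.continuous.intervalIntegrable _ _)
    (fun _ ht => Real.smoothTransition.pos_of_pos ht.1) hx

/-! ### Quadratic means of functions on a cylinder -/

theorem hasDerivAt_intervalIntegral_of_continuous {F F' : ℝ → ℝ → ℝ} {a b : ℝ}
    (hF : Continuous (Function.uncurry F)) (hF' : Continuous (Function.uncurry F'))
    (hd : ∀ s t, HasDerivAt (fun x => F x t) (F' s t) s) (s : ℝ) :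
    HasDerivAt (fun x => ∫ t in a..b, F x t) (∫ t in a..b, F' s t) s := by
  have hcF : ∀ x, Continuous (F x) := fun x => hF.comp (Continuous.prodMk_right x)
  have hcF' : ∀ x, Continuous (F' x) := fun x => hF'.comp (Continuous.prodMk_right x)
  obtain ⟨C, hC⟩ := ((isCompact_closedBall s 1).prod
    (isCompact_uIcc (a := a) (b := b))).exists_bound_of_continuousOn hF'.continuousOn
  refine (intervalIntegral.hasDerivAt_integral_of_dominated_loc_of_deriv_le (bound := fun _ => C)
    (Metric.closedBall_mem_nhds s one_pos)
    (Eventually.of_forall fun x => (hcF x).aestronglyMeasurable)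
    ((hcF s).intervalIntegrable _ _) (hcF' s).aestronglyMeasurable
    (Eventually.of_forall fun t ht x hx => hC (x, t) ⟨hx, Set.uIoc_subset_uIcc ht⟩)
    intervalIntegrable_const (Eventually.of_forall fun t _ x _ => hd x t)).2

/-- `w` is twice continuously differentiable on the cylinder `ℝ × ℝ/2πℤ`, with the indicated
partial derivatives. -/
structure IsCylinderC2 (w ws wss wt wtt : ℝ → ℝ → ℝ) : Prop where
  cont : Continuous (Function.uncurry w)
  cont_s : Continuous (Function.uncurry ws)
  cont_ss : Continuous (Function.uncurry wss)
  cont_t : Continuous (Function.uncurry wt)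
  cont_tt : Continuous (Function.uncurry wtt)
  deriv_s : ∀ s t, HasDerivAt (fun x => w x t) (ws s t) s
  deriv_ss : ∀ s t, HasDerivAt (fun x => ws x t) (wss s t) s
  deriv_t : ∀ s t, HasDerivAt (fun x => w s x) (wt s t) t
  deriv_tt : ∀ s t, HasDerivAt (fun x => wt s x) (wtt s t) t
  periodic : ∀ s, Function.Periodic (w s) (2 * Real.pi)
  periodic_t : ∀ s, Function.Periodic (wt s) (2 * Real.pi)

/-- The integral of `w²` over the circle at height `s`. -/
noncomputable def squareMean (w : ℝ → ℝ → ℝ) (s : ℝ) : ℝ :=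
  ∫ t in (0 : ℝ)..(2 * Real.pi), w s t ^ 2

theorem squareMean_nonneg (w : ℝ → ℝ → ℝ) (s : ℝ) : 0 ≤ squareMean w s :=
  intervalIntegral.integral_nonneg Real.two_pi_pos.le fun _ _ => sq_nonneg _

/-- The first derivative of `squareMean`. -/
noncomputable def squareMean' (w ws : ℝ → ℝ → ℝ) (s : ℝ) : ℝ :=
  ∫ t in (0 : ℝ)..(2 * Real.pi), 2 * (w s t * ws s t)

/-- The second derivative of `squareMean`. -/
noncomputable def squareMean'' (w ws wss : ℝ → ℝ → ℝ) (s : ℝ) : ℝ :=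
  ∫ t in (0 : ℝ)..(2 * Real.pi), 2 * (ws s t ^ 2 + w s t * wss s t)

namespace IsCylinderC2

variable {w ws wss wt wtt : ℝ → ℝ → ℝ} (H : IsCylinderC2 w ws wss wt wtt)

include H

theorem continuous_section (s : ℝ) : Continuous (w s) ∧ Continuous (ws s) ∧ Continuous (wss s) ∧
    Continuous (wt s) ∧ Continuous (wtt s) :=
  ⟨H.cont.comp (Continuous.prodMk_right s), H.cont_s.comp (Continuous.prodMk_right s),
    H.cont_ss.comp (Continuous.prodMk_right s), H.cont_t.comp (Continuous.prodMk_right s),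
    H.cont_tt.comp (Continuous.prodMk_right s)⟩

theorem hasDerivAt_squareMean (s : ℝ) :
    HasDerivAt (squareMean w) (squareMean' w ws s) s := by
  refine hasDerivAt_intervalIntegral_of_continuous (F := fun s t => w s t ^ 2)
    (F' := fun s t => 2 * (w s t * ws s t)) (H.cont.fun_pow 2)
    ((H.cont.mul H.cont_s).const_mul 2) (fun s t => ?_) s
  refine ((H.deriv_s s t).fun_pow 2).congr_deriv ?_
  norm_num
  ring

theorem hasDerivAt_squareMean' (s : ℝ) :
    HasDerivAt (squareMean' w ws) (squareMean'' w ws wss s) s := by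
  refine hasDerivAt_intervalIntegral_of_continuous (F := fun s t => 2 * (w s t * ws s t))
    (F' := fun s t => 2 * (ws s t ^ 2 + w s t * wss s t))
    ((H.cont.mul H.cont_s).const_mul 2)
    (((H.cont_s.fun_pow 2).fun_add (H.cont.fun_mul H.cont_ss)).const_mul 2) (fun s t => ?_) s
  refine (((H.deriv_s s t).mul (H.deriv_ss s t)).const_mul 2).congr_deriv ?_
  ring

theorem continuous_squareMean'' : Continuous (squareMean'' w ws wss) :=
  intervalIntegral.continuous_parametric_intervalIntegral_of_continuous'
    (f := fun s t => 2 * (ws s t ^ 2 + w s t * wss s t))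
    (((H.cont_s.fun_pow 2).fun_add (H.cont.fun_mul H.cont_ss)).const_mul 2) _ _

theorem integral_mul_wtt (s : ℝ) :
    ∫ t in (0 : ℝ)..(2 * Real.pi), w s t * wtt s t
      = - ∫ t in (0 : ℝ)..(2 * Real.pi), wt s t ^ 2 := by
  obtain ⟨-, -, -, ct, ctt⟩ := H.continuous_section s
  rw [intervalIntegral.integral_mul_deriv_eq_deriv_mul (fun t _ => H.deriv_t s t)
    (fun t _ => H.deriv_tt s t) (ct.intervalIntegrable _ _) (ctt.intervalIntegrable _ _)]
  have h1 := H.periodic s 0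
  have h2 := H.periodic_t s 0
  rw [zero_add] at h1 h2
  rw [h1, h2, sub_self, zero_sub]
  simp only [sq]

theorem le_squareMean'' {s e : ℝ} (h0 : ∀ t, 0 ≤ w s t) (hlap : ∀ t, -e ≤ wss s t + wtt s t) :
    2 * (∫ t in (0 : ℝ)..(2 * Real.pi), ws s t ^ 2) +
      2 * (∫ t in (0 : ℝ)..(2 * Real.pi), wt s t ^ 2)
      - 2 * e * (∫ t in (0 : ℝ)..(2 * Real.pi), w s t) ≤ squareMean'' w ws wss s := by
  obtain ⟨c, cs, css, ct, ctt⟩ := H.continuous_section s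
  have hI : ∀ {g : ℝ → ℝ}, Continuous g → IntervalIntegrable g volume 0 (2 * Real.pi) :=
    fun hg => hg.intervalIntegrable _ _
  have key : ∫ t in (0 : ℝ)..(2 * Real.pi), (ws s t ^ 2 - (w s t * wtt s t + e * w s t))
      ≤ ∫ t in (0 : ℝ)..(2 * Real.pi), (ws s t ^ 2 + w s t * wss s t) := by
    refine intervalIntegral.integral_mono_on Real.two_pi_pos.le (hI (by fun_prop))
      (hI (by fun_prop)) fun t _ => ?_
    nlinarith [mul_nonneg (h0 t) (by linarith [hlap t] : 0 ≤ wss s t + wtt s t + e)]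
  rw [intervalIntegral.integral_sub (hI (by fun_prop)) (hI (by fun_prop)),
    intervalIntegral.integral_add (hI (by fun_prop)) (hI (by fun_prop)),
    intervalIntegral.integral_const_mul, H.integral_mul_wtt] at key
  unfold squareMean''
  rw [intervalIntegral.integral_const_mul]
  linarith

theorem squareMean''_nonneg {s : ℝ} (h0 : ∀ t, 0 ≤ w s t) (hlap : ∀ t, 0 ≤ wss s t + wtt s t) :
    0 ≤ squareMean'' w ws wss s := by
  have := H.le_squareMean'' (e := 0) h0 (by simpa using hlap)
  have h1 : 0 ≤ ∫ t in (0 : ℝ)..(2 * Real.pi), ws s t ^ 2 :=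
    intervalIntegral.integral_nonneg Real.two_pi_pos.le fun _ _ => sq_nonneg _
  have h2 : 0 ≤ ∫ t in (0 : ℝ)..(2 * Real.pi), wt s t ^ 2 :=
    intervalIntegral.integral_nonneg Real.two_pi_pos.le fun _ _ => sq_nonneg _
  linarith

/-- Carleman's differential inequality for the quadratic mean, with an error term. -/
theorem carleman_inequality {s e m : ℝ} (h0 : ∀ t, 0 ≤ w s t)
    (hlap : ∀ t, -e ≤ wss s t + wtt s t) {t₀ : ℝ} (ht₀ : w s t₀ = 0) (hm : 0 < m)
    (hle : supportLength (w s) 0 (2 * Real.pi) ≤ m) :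
    2 * (∫ t in (0 : ℝ)..(2 * Real.pi), ws s t ^ 2) + 2 * (Real.pi / m) ^ 2 * squareMean w s
      - 2 * e * (∫ t in (0 : ℝ)..(2 * Real.pi), w s t) ≤ squareMean'' w ws wss s := by
  have h1 := H.le_squareMean'' h0 hlap
  have h2 := wirtinger_periodic (fun t => H.deriv_t s t) (H.continuous_section s).2.2.2.1
    Real.two_pi_pos.le (H.periodic s) (H.periodic_t s) ht₀ hm hle
  unfold squareMean
  linarith

theorem squareMean'_le (s p : ℝ) :
    2 * p * squareMean' w ws s
      ≤ 2 * (∫ t in (0 : ℝ)..(2 * Real.pi), ws s t ^ 2) + 2 * p ^ 2 * squareMean w s := by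
  obtain ⟨c, cs, -⟩ := H.continuous_section s
  have hI : ∀ {g : ℝ → ℝ}, Continuous g → IntervalIntegrable g volume 0 (2 * Real.pi) :=
    fun hg => hg.intervalIntegrable _ _
  unfold squareMean' squareMean
  rw [← intervalIntegral.integral_const_mul, ← intervalIntegral.integral_const_mul,
    ← intervalIntegral.integral_const_mul, ← intervalIntegral.integral_add (hI (by fun_prop))
      (hI (by fun_prop))]
  refine intervalIntegral.integral_mono_on Real.two_pi_pos.le (hI (by fun_prop))
    (hI (by fun_prop)) fun t _ => ?_
  nlinarith [sq_nonneg (ws s t - p * w s t)]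

/-- A linearised Cauchy–Schwarz bound; the weight `a` is later taken to be `e^{-s/2}`, which
balances the two terms when `J` is of order `e^s`. -/
theorem integral_le (s : ℝ) {a : ℝ} (ha : 0 < a) :
    ∫ t in (0 : ℝ)..(2 * Real.pi), w s t ≤ a * squareMean w s + 2 * Real.pi / a := by
  obtain ⟨c, -⟩ := H.continuous_section s
  have hI : ∀ {g : ℝ → ℝ}, Continuous g → IntervalIntegrable g volume 0 (2 * Real.pi) :=
    fun hg => hg.intervalIntegrable _ _
  have : ∫ t in (0 : ℝ)..(2 * Real.pi), w s t
      ≤ ∫ t in (0 : ℝ)..(2 * Real.pi), (a * w s t ^ 2 + 1 / a) := by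
    refine intervalIntegral.integral_mono_on Real.two_pi_pos.le (hI (by fun_prop))
      (hI (by fun_prop)) fun t _ => ?_
    have h1 : a * w s t ^ 2 + 1 / a - w s t = ((a * w s t - 1 / 2) ^ 2 + 3 / 4) / a := by
      field_simp; ring
    have h2 : 0 ≤ ((a * w s t - 1 / 2) ^ 2 + 3 / 4) / a := by positivity
    linarith
  rw [intervalIntegral.integral_add (hI (by fun_prop)) (hI (by fun_prop)),
    intervalIntegral.integral_const_mul] at this
  simp at this
  unfold squareMean
  rw [div_eq_mul_inv]
  exact this

end IsCylinderC2

/-! ### The logarithm of the modulus of an entire function in logarithmic coordinates -/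

theorem hasDerivAt_log_norm {γ : ℝ → ℂ} {γ' : ℂ} {x : ℝ} (h : HasDerivAt γ γ' x) (h0 : γ x ≠ 0) :
    HasDerivAt (fun y => Real.log ‖γ y‖) (γ' / γ x).re x := by
  have hn : ‖γ x‖ ^ 2 ≠ 0 := pow_ne_zero _ (norm_ne_zero_iff.2 h0)
  have h1 := (h.norm_sq.log hn).const_mul (1 / 2 : ℝ)
  have h2 : (fun y => (1 / 2 : ℝ) * Real.log (‖γ y‖ ^ 2)) = fun y => Real.log ‖γ y‖ := by
    funext y
    rw [Real.log_pow]
    push_cast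
    ring
  rw [h2] at h1
  refine h1.congr_deriv ?_
  rw [Complex.inner, Complex.div_re, ← Complex.normSq_eq_norm_sq]
  simp only [Complex.mul_re, Complex.conj_re, Complex.conj_im]
  ring

theorem hasDerivAt_add_mul_I_left (s t : ℝ) :
    HasDerivAt (fun x : ℝ => (x : ℂ) + t * Complex.I) 1 s := by
  simpa using (Complex.ofRealCLM.hasDerivAt (x := s)).add_const ((t : ℂ) * Complex.I)

theorem hasDerivAt_add_mul_I_right (s t : ℝ) :
    HasDerivAt (fun x : ℝ => (s : ℂ) + x * Complex.I) Complex.I t := by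
  simpa using ((Complex.ofRealCLM.hasDerivAt (x := t)).mul_const Complex.I).const_add (s : ℂ)

/-- The point with logarithmic polar coordinates `p`, before exponentiation. -/
noncomputable def logPoint (p : ℝ × ℝ) : ℂ := (p.1 : ℂ) + p.2 * Complex.I

theorem continuous_logPoint : Continuous logPoint := by
  unfold logPoint
  fun_prop

/-- The logarithmic derivative of `f ∘ exp`. -/
noncomputable def expLogDeriv (f : ℂ → ℂ) (ζ : ℂ) : ℂ :=
  deriv (fun ζ => f (Complex.exp ζ)) ζ / f (Complex.exp ζ)

section

variable {f : ℂ → ℂ} (hf : Differentiable ℂ f)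

include hf

theorem differentiable_comp_exp : Differentiable ℂ fun ζ => f (Complex.exp ζ) :=
  hf.comp Complex.differentiable_exp

theorem isOpen_comp_exp_ne_zero : IsOpen {ζ | f (Complex.exp ζ) ≠ 0} :=
  isOpen_ne_fun (differentiable_comp_exp hf).continuous continuous_const

theorem differentiableOn_expLogDeriv :
    DifferentiableOn ℂ (expLogDeriv f) {ζ | f (Complex.exp ζ) ≠ 0} := by
  have h1 := differentiable_comp_exp hf
  have h2 : Differentiable ℂ (deriv fun ζ => f (Complex.exp ζ)) :=
    fun ζ => (h1.differentiableOn (s := Set.univ)).deriv isOpen_univ |>.differentiableAt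
      (isOpen_univ.mem_nhds trivial)
  exact h2.differentiableOn.div h1.differentiableOn fun ζ hζ => hζ

theorem hasDerivAt_expLogDeriv {ζ : ℂ} (hζ : f (Complex.exp ζ) ≠ 0) :
    HasDerivAt (expLogDeriv f) (deriv (expLogDeriv f) ζ) ζ :=
  ((differentiableOn_expLogDeriv hf).differentiableAt
    ((isOpen_comp_exp_ne_zero hf).mem_nhds hζ)).hasDerivAt

theorem continuousOn_deriv_expLogDeriv :
    ContinuousOn (deriv (expLogDeriv f)) {ζ | f (Complex.exp ζ) ≠ 0} :=
  ((differentiableOn_expLogDeriv hf).deriv (isOpen_comp_exp_ne_zero hf)).continuousOn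

/-- All derivatives of `log|f ∘ exp|` are read off from the logarithmic derivative, so no branch of
the logarithm is chosen. The velocities `γ' = 1` and `γ' = I` give the two partial derivatives. -/
theorem hasDerivAt_log_norm_comp {γ : ℝ → ℂ} {γ' : ℂ} {x : ℝ} (h : HasDerivAt γ γ' x)
    (h0 : f (Complex.exp (γ x)) ≠ 0) :
    HasDerivAt (fun y => Real.log ‖f (Complex.exp (γ y))‖) (expLogDeriv f (γ x) * γ').re x := by
  have h1 := ((differentiable_comp_exp hf) (γ x)).hasDerivAt.comp_of_eq x h rfl
  refine (hasDerivAt_log_norm h1 h0).congr_deriv ?_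
  rw [expLogDeriv, div_mul_eq_mul_div]
  rfl

end

/-! ### The smoothed growth function of a tract -/

/-- `log|f| - c|z|^β - K` in logarithmic polar coordinates. -/
noncomputable def tractHeight (f : ℂ → ℂ) (β c K : ℝ) (p : ℝ × ℝ) : ℝ :=
  Real.log ‖f (Complex.exp (logPoint p))‖ - c * Real.exp (β * p.1) - K

/-- The `s`-derivative of `tractHeight`. -/
noncomputable def tractHeightS (f : ℂ → ℂ) (β c : ℝ) (p : ℝ × ℝ) : ℝ :=
  (expLogDeriv f (logPoint p)).re - c * β * Real.exp (β * p.1)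

/-- The second `s`-derivative of `tractHeight`. -/
noncomputable def tractHeightSS (f : ℂ → ℂ) (β c : ℝ) (p : ℝ × ℝ) : ℝ :=
  (deriv (expLogDeriv f) (logPoint p)).re - c * β ^ 2 * Real.exp (β * p.1)

/-- The `t`-derivative of `tractHeight`. -/
noncomputable def tractHeightT (f : ℂ → ℂ) (p : ℝ × ℝ) : ℝ :=
  -(expLogDeriv f (logPoint p)).im

/-- The second `t`-derivative of `tractHeight`. -/
noncomputable def tractHeightTT (f : ℂ → ℂ) (p : ℝ × ℝ) : ℝ :=
  -(deriv (expLogDeriv f) (logPoint p)).re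

/-- The preimage of `U` in logarithmic polar coordinates. -/
def logPreimage (U : Set ℂ) : Set (ℝ × ℝ) := {p | Complex.exp (logPoint p) ∈ U}

/-- `f` has no zero on the open set `U`, and `log|f| < K` in `U` near the complement of `U`. -/
structure IsTract (f : ℂ → ℂ) (U : Set ℂ) (K : ℝ) : Prop where
  differentiable : Differentiable ℂ f
  isOpen : IsOpen U
  ne_zero : ∀ z ∈ U, f z ≠ 0
  boundary : ∀ z ∉ U, ∀ᶠ y in nhds z, y ∈ U → Real.log ‖f y‖ < K

/-- Because `Φ` already vanishes in `Ω` near each point outside `Ω`, extension by zero needs no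
regularity of the boundary. -/
theorem continuous_indicator_of_eventually {Ω : Set (ℝ × ℝ)} (hΩ : IsOpen Ω) {Φ : ℝ × ℝ → ℝ}
    (hΦ : ContinuousOn Φ Ω) (h0 : ∀ p ∉ Ω, ∀ᶠ q in nhds p, q ∈ Ω → Φ q = 0) :
    Continuous (Ω.indicator Φ) := by
  refine continuous_iff_continuousAt.2 fun p => ?_
  by_cases hp : p ∈ Ω
  · refine (hΦ.continuousAt (hΩ.mem_nhds hp)).congr ?_
    filter_upwards [hΩ.mem_nhds hp] with q hq
    exact (Set.indicator_of_mem hq Φ).symm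
  · refine (continuousAt_const (y := (0 : ℝ))).congr ?_
    filter_upwards [h0 p hp] with q hq
    by_cases hqΩ : q ∈ Ω
    · rw [Set.indicator_of_mem hqΩ, hq hqΩ]
    · rw [Set.indicator_of_notMem hqΩ]

theorem hasDerivAt_indicator_of_eventually {Ω : Set (ℝ × ℝ)} (hΩ : IsOpen Ω)
    {Φ Φ' : ℝ × ℝ → ℝ} (h0 : ∀ p ∉ Ω, ∀ᶠ q in nhds p, q ∈ Ω → Φ q = 0)
    {γ : ℝ → ℝ × ℝ} (hγ : Continuous γ) {x : ℝ}
    (hd : γ x ∈ Ω → HasDerivAt (fun y => Φ (γ y)) (Φ' (γ x)) x) :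
    HasDerivAt (fun y => Ω.indicator Φ (γ y)) (Ω.indicator Φ' (γ x)) x := by
  by_cases hp : γ x ∈ Ω
  · rw [Set.indicator_of_mem hp]
    refine (hd hp).congr_of_eventuallyEq ?_
    filter_upwards [hγ.continuousAt.eventually (hΩ.mem_nhds hp)] with q hq
    exact Set.indicator_of_mem hq Φ
  · rw [Set.indicator_of_notMem hp]
    refine (hasDerivAt_const x (0 : ℝ)).congr_of_eventuallyEq ?_
    filter_upwards [hγ.continuousAt.eventually (h0 _ hp)] with q hq
    by_cases hqΩ : γ q ∈ Ω
    · rw [Set.indicator_of_mem hqΩ, hq hqΩ]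
    · rw [Set.indicator_of_notMem hqΩ]

theorem deriv_smoothTransition_of_neg {x : ℝ} (hx : x < 0) : deriv Real.smoothTransition x = 0 := by
  have : Real.smoothTransition =ᶠ[nhds x] fun _ => 0 := by
    filter_upwards [Iio_mem_nhds hx] with y hy
    exact Real.smoothTransition.zero_of_nonpos (le_of_lt hy)
  rw [this.deriv_eq, deriv_const]

/-- The smoothed positive part of `log|f| - c|z|^β - K` on `U`, extended by zero. -/
noncomputable def tractFun (f : ℂ → ℂ) (U : Set ℂ) (β c K s t : ℝ) : ℝ :=
  (logPreimage U).indicator (fun p => smoothPos (tractHeight f β c K p)) (s, t)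

/-- The `s`-derivative of `tractFun`. -/
noncomputable def tractFunS (f : ℂ → ℂ) (U : Set ℂ) (β c K s t : ℝ) : ℝ :=
  (logPreimage U).indicator
    (fun p => Real.smoothTransition (tractHeight f β c K p) * tractHeightS f β c p) (s, t)

/-- The second `s`-derivative of `tractFun`. -/
noncomputable def tractFunSS (f : ℂ → ℂ) (U : Set ℂ) (β c K s t : ℝ) : ℝ :=
  (logPreimage U).indicator
    (fun p => deriv Real.smoothTransition (tractHeight f β c K p) * tractHeightS f β c p *
        tractHeightS f β c p
      + Real.smoothTransition (tractHeight f β c K p) * tractHeightSS f β c p) (s, t)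

/-- The `t`-derivative of `tractFun`. -/
noncomputable def tractFunT (f : ℂ → ℂ) (U : Set ℂ) (β c K s t : ℝ) : ℝ :=
  (logPreimage U).indicator
    (fun p => Real.smoothTransition (tractHeight f β c K p) * tractHeightT f p) (s, t)

/-- The second `t`-derivative of `tractFun`. -/
noncomputable def tractFunTT (f : ℂ → ℂ) (U : Set ℂ) (β c K s t : ℝ) : ℝ :=
  (logPreimage U).indicator
    (fun p => deriv Real.smoothTransition (tractHeight f β c K p) * tractHeightT f p *
        tractHeightT f p
      + Real.smoothTransition (tractHeight f β c K p) * tractHeightTT f p) (s, t)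

theorem tractFun_nonneg (f : ℂ → ℂ) (U : Set ℂ) (β c K s t : ℝ) : 0 ≤ tractFun f U β c K s t :=
  Set.indicator_nonneg (fun _ _ => smoothPos_nonneg _) _

theorem logPoint_add_two_pi (s t : ℝ) :
    logPoint (s, t + 2 * Real.pi) = logPoint (s, t) + 2 * Real.pi * Complex.I := by
  simp only [logPoint]
  push_cast
  ring

theorem exp_logPoint_add_two_pi (s t : ℝ) :
    Complex.exp (logPoint (s, t + 2 * Real.pi)) = Complex.exp (logPoint (s, t)) := by
  rw [logPoint_add_two_pi, Complex.exp_periodic]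

theorem expLogDeriv_periodic (f : ℂ → ℂ) :
    Function.Periodic (expLogDeriv f) (2 * Real.pi * Complex.I) := by
  intro ζ
  unfold expLogDeriv
  rw [Complex.exp_periodic, ← deriv_comp_add_const]
  simp only [Complex.exp_periodic _]

theorem mem_logPreimage_add_two_pi {U : Set ℂ} {s t : ℝ} :
    (s, t + 2 * Real.pi) ∈ logPreimage U ↔ (s, t) ∈ logPreimage U := by
  simp only [logPreimage, Set.mem_ofPred_eq, exp_logPoint_add_two_pi]

theorem indicator_logPreimage_periodic (U : Set ℂ) {Φ : ℝ × ℝ → ℝ} {s : ℝ}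
    (hΦ : ∀ t, Φ (s, t + 2 * Real.pi) = Φ (s, t)) :
    Function.Periodic (fun t => (logPreimage U).indicator Φ (s, t)) (2 * Real.pi) := by
  intro t
  by_cases h : (s, t) ∈ logPreimage U
  · simp only [Set.indicator_of_mem h, Set.indicator_of_mem (mem_logPreimage_add_two_pi.2 h), hΦ]
  · simp only [Set.indicator_of_notMem h,
      Set.indicator_of_notMem (mt mem_logPreimage_add_two_pi.1 h)]

theorem tractFun_periodic (f : ℂ → ℂ) (U : Set ℂ) (β c K s : ℝ) :
    Function.Periodic (tractFun f U β c K s) (2 * Real.pi) :=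
  indicator_logPreimage_periodic U fun t => by
    simp only [tractHeight, exp_logPoint_add_two_pi]

theorem tractFunT_periodic (f : ℂ → ℂ) (U : Set ℂ) (β c K s : ℝ) :
    Function.Periodic (tractFunT f U β c K s) (2 * Real.pi) :=
  indicator_logPreimage_periodic U fun t => by
    simp only [tractHeight, tractHeightT, exp_logPoint_add_two_pi]
    simp only [logPoint_add_two_pi, (expLogDeriv_periodic f) _]

namespace IsTract

variable {f : ℂ → ℂ} {U : Set ℂ} {K : ℝ} (T : IsTract f U K)

include T

theorem isOpen_logPreimage : IsOpen (logPreimage U) :=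
  T.isOpen.preimage (Complex.continuous_exp.comp continuous_logPoint)

theorem eventually_tractHeight_neg {β c : ℝ} (hc : 0 ≤ c) :
    ∀ p ∉ logPreimage U, ∀ᶠ q in nhds p, q ∈ logPreimage U → tractHeight f β c K q < 0 := by
  intro p hp
  have hcont : ContinuousAt (fun q => Complex.exp (logPoint q)) p :=
    (Complex.continuous_exp.comp continuous_logPoint).continuousAt
  filter_upwards [hcont.eventually (T.boundary _ hp)] with q hq hqU
  have := hq hqU
  have := mul_nonneg hc (Real.exp_pos (β * q.1)).le
  unfold tractHeight
  linarith

theorem continuousOn_tractHeight (β c : ℝ) : ContinuousOn (tractHeight f β c K) (logPreimage U) := by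
  have hF : Continuous fun p => f (Complex.exp (logPoint p)) :=
    T.differentiable.continuous.comp (Complex.continuous_exp.comp continuous_logPoint)
  have : ContinuousOn (fun p => Real.log ‖f (Complex.exp (logPoint p))‖) (logPreimage U) :=
    hF.norm.continuousOn.log fun p hp => norm_ne_zero_iff.2 (T.ne_zero _ hp)
  unfold tractHeight
  fun_prop

theorem mapsTo_logPoint :
    Set.MapsTo logPoint (logPreimage U) {ζ | f (Complex.exp ζ) ≠ 0} :=
  fun _ hp => T.ne_zero _ hp

theorem continuousOn_expLogDeriv :
    ContinuousOn (fun p => expLogDeriv f (logPoint p)) (logPreimage U) :=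
  (differentiableOn_expLogDeriv T.differentiable).continuousOn.comp
    continuous_logPoint.continuousOn T.mapsTo_logPoint

theorem continuousOn_deriv_expLogDeriv :
    ContinuousOn (fun p => deriv (expLogDeriv f) (logPoint p)) (logPreimage U) :=
  (_root_.continuousOn_deriv_expLogDeriv T.differentiable).comp
    continuous_logPoint.continuousOn T.mapsTo_logPoint

theorem isCylinderC2 (β : ℝ) {c : ℝ} (hc : 0 ≤ c) :
    IsCylinderC2 (tractFun f U β c K) (tractFunS f U β c K) (tractFunSS f U β c K)
      (tractFunT f U β c K) (tractFunTT f U β c K) := by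
  have hΩ := T.isOpen_logPreimage
  have hneg := T.eventually_tractHeight_neg (β := β) hc
  have cg := T.continuousOn_tractHeight β c
  have cL := T.continuousOn_expLogDeriv
  have cL' := T.continuousOn_deriv_expLogDeriv
  have cre : Continuous fun z : ℂ => z.re := Complex.continuous_re
  have cim : Continuous fun z : ℂ => z.im := Complex.continuous_im
  have cgs : ContinuousOn (tractHeightS f β c) (logPreimage U) := by
    have := cre.comp_continuousOn cL
    unfold tractHeightS
    fun_prop
  have cgss : ContinuousOn (tractHeightSS f β c) (logPreimage U) := by
    have := cre.comp_continuousOn cL'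
    unfold tractHeightSS
    fun_prop
  have cgt : ContinuousOn (tractHeightT f) (logPreimage U) := (cim.comp_continuousOn cL).neg
  have cgtt : ContinuousOn (tractHeightTT f) (logPreimage U) := (cre.comp_continuousOn cL').neg
  have c0 := continuous_smoothPos.comp_continuousOn cg
  have c1 := Real.smoothTransition.continuous.comp_continuousOn cg
  have c2 := continuous_deriv_smoothTransition.comp_continuousOn cg
  have z0 : ∀ p ∉ logPreimage U, ∀ᶠ q in nhds p, q ∈ logPreimage U →
      smoothPos (tractHeight f β c K q) = 0 := fun p hp => (hneg p hp).mono fun q hq hqU =>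
    smoothPos_of_nonpos (hq hqU).le
  have z1 : ∀ p ∉ logPreimage U, ∀ᶠ q in nhds p, q ∈ logPreimage U →
      Real.smoothTransition (tractHeight f β c K q) = 0 := fun p hp => (hneg p hp).mono
    fun q hq hqU => Real.smoothTransition.zero_of_nonpos (hq hqU).le
  have z2 : ∀ p ∉ logPreimage U, ∀ᶠ q in nhds p, q ∈ logPreimage U →
      deriv Real.smoothTransition (tractHeight f β c K q) = 0 := fun p hp => (hneg p hp).mono
    fun q hq hqU => deriv_smoothTransition_of_neg (hq hqU)
  have dgs : ∀ s t : ℝ, (s, t) ∈ logPreimage U →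
      HasDerivAt (fun x => tractHeight f β c K (x, t)) (tractHeightS f β c (s, t)) s := by
    intro s t h
    have h1 := hasDerivAt_log_norm_comp T.differentiable (hasDerivAt_add_mul_I_left s t)
      (T.ne_zero _ h)
    have h2 := (((hasDerivAt_id' s).const_mul β).exp.const_mul c)
    refine ((h1.sub h2).sub_const K).congr_deriv ?_
    simp only [tractHeightS, logPoint]
    rw [mul_one]
    ring
  have dgss : ∀ s t : ℝ, (s, t) ∈ logPreimage U →
      HasDerivAt (fun x => tractHeightS f β c (x, t)) (tractHeightSS f β c (s, t)) s := by
    intro s t h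
    have h1 := ((hasDerivAt_expLogDeriv T.differentiable (T.ne_zero _ h)).comp_of_eq s
      (hasDerivAt_add_mul_I_left s t) rfl)
    have h1' := Complex.reCLM.hasFDerivAt.comp_hasDerivAt s h1
    have h2 := (((hasDerivAt_id' s).const_mul β).exp.const_mul (c * β))
    refine (h1'.sub h2).congr_deriv ?_
    simp only [tractHeightSS, mul_one, Complex.reCLM_apply]
    ring
  have dgt : ∀ s t : ℝ, (s, t) ∈ logPreimage U →
      HasDerivAt (fun x => tractHeight f β c K (s, x)) (tractHeightT f (s, t)) t := by
    intro s t h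
    have h1 := hasDerivAt_log_norm_comp T.differentiable (hasDerivAt_add_mul_I_right s t)
      (T.ne_zero _ h)
    refine ((h1.sub_const (c * Real.exp (β * s))).sub_const K).congr_deriv ?_
    simp [tractHeightT, logPoint]
  have dgtt : ∀ s t : ℝ, (s, t) ∈ logPreimage U →
      HasDerivAt (fun x => tractHeightT f (s, x)) (tractHeightTT f (s, t)) t := by
    intro s t h
    have h1 := ((hasDerivAt_expLogDeriv T.differentiable (T.ne_zero _ h)).comp_of_eq t
      (hasDerivAt_add_mul_I_right s t) rfl)
    have h1' := Complex.imCLM.hasFDerivAt.comp_hasDerivAt t h1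
    refine h1'.neg.congr_deriv ?_
    simp [tractHeightTT]
  refine ⟨?_, ?_, ?_, ?_, ?_, ?_, ?_, ?_, ?_, tractFun_periodic f U β c K,
    tractFunT_periodic f U β c K⟩
  · exact continuous_indicator_of_eventually hΩ c0 z0
  · exact continuous_indicator_of_eventually hΩ (c1.mul cgs) fun p hp => (z1 p hp).mono
      fun q hq hqU => by simp [hq hqU]
  · exact continuous_indicator_of_eventually hΩ (((c2.mul cgs).mul cgs).add (c1.mul cgss))
      fun p hp => ((z1 p hp).and (z2 p hp)).mono
      fun q hq hqU => by simp [hq.1 hqU, hq.2 hqU]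
  · exact continuous_indicator_of_eventually hΩ (c1.mul cgt) fun p hp => (z1 p hp).mono
      fun q hq hqU => by simp [hq hqU]
  · exact continuous_indicator_of_eventually hΩ (((c2.mul cgt).mul cgt).add (c1.mul cgtt))
      fun p hp => ((z1 p hp).and (z2 p hp)).mono
      fun q hq hqU => by simp [hq.1 hqU, hq.2 hqU]
  · intro s t
    refine hasDerivAt_indicator_of_eventually hΩ z0 (γ := fun x => (x, t)) (by fun_prop)
      fun h => ?_
    exact (hasDerivAt_smoothPos _).comp s (dgs s t h)
  · intro s t
    refine hasDerivAt_indicator_of_eventually hΩ (fun p hp => (z1 p hp).mono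
      fun q hq hqU => by simp [hq hqU]) (γ := fun x => (x, t)) (by fun_prop) fun h => ?_
    exact ((hasDerivAt_smoothTransition _).comp s (dgs s t h)).mul (dgss s t h)
  · intro s t
    refine hasDerivAt_indicator_of_eventually hΩ z0 (γ := fun x => (s, x)) (by fun_prop)
      fun h => ?_
    exact (hasDerivAt_smoothPos _).comp t (dgt s t h)
  · intro s t
    refine hasDerivAt_indicator_of_eventually hΩ (fun p hp => (z1 p hp).mono
      fun q hq hqU => by simp [hq hqU]) (γ := fun x => (s, x)) (by fun_prop) fun h => ?_
    exact ((hasDerivAt_smoothTransition _).comp t (dgt s t h)).mul (dgtt s t h)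

end IsTract

/-- For `φ = smoothPos` and `g = tractHeight`, the Laplacian is `φ''|∇g|² + φ' Δg` with `φ'' ≥ 0`
and `0 ≤ φ' ≤ 1`; harmonicity of `log|f|` leaves only `Δg = -c β² e^{βs}`. -/
theorem neg_le_laplacian_tractFun (f : ℂ → ℂ) (U : Set ℂ) (β K s t : ℝ) {c : ℝ}
    (hc : 0 ≤ c) : -(c * β ^ 2 * Real.exp (β * s))
      ≤ tractFunSS f U β c K s t + tractFunTT f U β c K s t := by
  have he : 0 ≤ c * β ^ 2 * Real.exp (β * s) := by positivity
  by_cases h : (s, t) ∈ logPreimage U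
  · simp only [tractFunSS, tractFunTT, Set.indicator_of_mem h, tractHeightSS, tractHeightTT]
    have h1 := Real.smoothTransition.nonneg (tractHeight f β c K (s, t))
    have h2 := Real.smoothTransition.le_one (tractHeight f β c K (s, t))
    have h3 := deriv_smoothTransition_nonneg (tractHeight f β c K (s, t))
    nlinarith [mul_nonneg h3 (sq_nonneg (tractHeightS f β c (s, t))),
      mul_nonneg h3 (sq_nonneg (tractHeightT f (s, t))), mul_nonneg he (sub_nonneg.2 h2)]
  · simp only [tractFunSS, tractFunTT, Set.indicator_of_notMem h]
    linarith

theorem isTract_of_isComponentOf {f : ℂ → ℂ} (hf : Differentiable ℂ f) {R : ℝ} (hR : 0 < R)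
    {U : Set ℂ} (hU : IsComponentOf U (superlevel f R)) {K : ℝ} (hK : Real.log R < K) :
    IsTract f U K := by
  obtain ⟨z₀, -, rfl⟩ := hU
  have hA : IsOpen (superlevel f R) := isOpen_lt continuous_const hf.continuous.norm
  have hsub : ∀ z ∈ connectedComponentIn (superlevel f R) z₀, R < ‖f z‖ :=
    fun z hz => (connectedComponentIn_subset (superlevel f R) z₀ hz : z ∈ superlevel f R)
  refine ⟨hf, hA.connectedComponentIn, fun z hz => norm_pos_iff.1 (hR.trans (hsub z hz)),
    fun z hz => ?_⟩
  -- Either `z` lies in another component, which is open and misses `U`, or `|f(z)| ≤ R < e^K` and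
  -- continuity applies.
  by_cases hzA : z ∈ superlevel f R
  · filter_upwards [connectedComponentIn_mem_nhds (hA.mem_nhds hzA)] with y hy hyU
    refine absurd ?_ hz
    rw [connectedComponentIn_eq hyU, ← connectedComponentIn_eq hy]
    exact mem_connectedComponentIn hzA
  · have h1 : ‖f z‖ < Real.exp K :=
      lt_of_le_of_lt (not_lt.1 hzA) ((Real.log_lt_iff_lt_exp hR).1 hK)
    filter_upwards [hf.continuous.norm.continuousAt.eventually_lt continuousAt_const h1]
      with y hy hyU
    exact (Real.log_lt_iff_lt_exp (hR.trans (hsub y hyU))).2 hy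

theorem exp_logPoint (s t : ℝ) :
    Complex.exp (logPoint (s, t)) = (Real.exp s : ℂ) * Complex.exp (t * Complex.I) := by
  rw [logPoint, Complex.exp_add, Complex.ofReal_exp]

theorem norm_exp_logPoint (s t : ℝ) : ‖Complex.exp (logPoint (s, t))‖ = Real.exp s := by
  rw [Complex.norm_exp]
  simp [logPoint]

theorem exists_exp_logPoint {z : ℂ} {s : ℝ} (hz : ‖z‖ = Real.exp s) :
    ∃ t, Complex.exp (logPoint (s, t)) = z :=
  ⟨Complex.arg z, by rw [exp_logPoint, ← hz, Complex.norm_mul_exp_arg_mul_I]⟩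

/-! ### Elementary bounds -/

theorem tractFun_le {f : ℂ → ℂ} {U : Set ℂ} {β c K s t B M : ℝ} (hc : 0 ≤ c)
    (hU : ∀ z ∈ U, f z ≠ 0) (hB : ‖f (Complex.exp (logPoint (s, t)))‖ ≤ B) (hM : 0 ≤ M)
    (hBM : Real.log B - K ≤ M) : tractFun f U β c K s t ≤ M := by
  unfold tractFun
  by_cases h : (s, t) ∈ logPreimage U
  · rw [Set.indicator_of_mem h]
    have h1 := Real.log_le_log (norm_pos_iff.2 (hU _ h)) hB
    have h2 : tractHeight f β c K (s, t) ≤ M := by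
      have := mul_nonneg hc (Real.exp_pos (β * s)).le
      simp only [tractHeight]
      linarith
    exact (smoothPos_monotone h2).trans (smoothPos_le hM)
  · rwa [Set.indicator_of_notMem h]

theorem squareMean_mono {w v : ℝ → ℝ → ℝ} {s : ℝ} (hw : Continuous (w s)) (hv : Continuous (v s))
    (h0 : ∀ t, 0 ≤ w s t) (h : ∀ t, w s t ≤ v s t) : squareMean w s ≤ squareMean v s :=
  intervalIntegral.integral_mono_on Real.two_pi_pos.le ((hw.pow 2).intervalIntegrable _ _)
    ((hv.pow 2).intervalIntegrable _ _) fun t _ => pow_le_pow_left₀ (h0 t) (h t) 2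

theorem squareMean_le {w : ℝ → ℝ → ℝ} {s M : ℝ} (hw : Continuous (w s))
    (h0 : ∀ t, 0 ≤ w s t) (h : ∀ t, w s t ≤ M) : squareMean w s ≤ 2 * Real.pi * M ^ 2 := by
  refine (squareMean_mono (v := fun _ _ => M) hw continuous_const h0 h).trans_eq ?_
  simp [squareMean]

theorem squareMean_pos {w : ℝ → ℝ → ℝ} {s t : ℝ} (hw : Continuous (w s))
    (hp : Function.Periodic (w s) (2 * Real.pi)) (ht : w s t ≠ 0) : 0 < squareMean w s := by
  obtain ⟨y, hy, hty⟩ := hp.exists_mem_Ico₀ Real.two_pi_pos t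
  refine intervalIntegral.integral_pos Real.two_pi_pos (hw.pow 2).continuousOn
    (fun _ _ => sq_nonneg _) ⟨y, Set.Ico_subset_Icc_self hy, ?_⟩
  rw [← hty]
  positivity

theorem supportLength_le_volume {h : ℝ → ℝ} (hc : Continuous h) {b : ℝ} (hb : 0 ≤ b) {S : Set ℝ}
    (hS : S ⊆ Set.Icc 0 b) (hsub : ∀ t ∈ Set.Icc 0 b, h t ≠ 0 → t ∈ S) :
    supportLength h 0 b ≤ volume.real S := by
  unfold supportLength
  rw [intervalIntegral.integral_of_le hb, setIntegral_indicator (measurableSet_ne_zero hc),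
    setIntegral_const, smul_eq_mul, mul_one]
  refine measureReal_mono (fun t ht => hsub t (Set.Ioc_subset_Icc_self ht.1) ht.2) ?_
  exact ((measure_mono hS).trans_lt (by simp)).ne

/-! ### Growth lemmas for functions of one variable -/

theorem le_of_hasDerivAt_nonneg {F F' : ℝ → ℝ} {a : ℝ} (hd : ∀ s, a ≤ s → HasDerivAt F (F' s) s)
    (h0 : ∀ s, a ≤ s → 0 ≤ F' s) {s t : ℝ} (has : a ≤ s) (hst : s ≤ t) : F s ≤ F t := by
  have : MonotoneOn F (Set.Ici a) := by
    refine monotoneOn_of_deriv_nonneg (convex_Ici a)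
      (fun x hx => (hd x hx).continuousAt.continuousWithinAt)
      (fun x hx => (hd x (interior_subset hx)).differentiableAt.differentiableWithinAt)
      fun x hx => ?_
    rw [(hd x (interior_subset hx)).deriv]
    exact h0 x (interior_subset hx)
  exact this has (has.trans hst) hst

/-- A convex function with negative slope at `a` lies above its tangent there and is unbounded
towards `-∞`. For the quadratic mean, `s → -∞` means `z → 0`, where `f` is bounded. -/
theorem deriv_nonneg_of_bounded_left {J J' J'' : ℝ → ℝ} (h1 : ∀ s, HasDerivAt J (J' s) s)
    (h2 : ∀ s, HasDerivAt J' (J'' s) s) (h0 : ∀ s, 0 ≤ J'' s)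
    (hb : ∀ a, ∃ C, ∀ s ≤ a, J s ≤ C) (a : ℝ) : 0 ≤ J' a := by
  by_contra! hneg
  obtain ⟨C, hC⟩ := hb a
  have hmono : Monotone J' := monotone_of_deriv_nonneg (fun s => (h2 s).differentiableAt)
    fun s => by rw [(h2 s).deriv]; exact h0 s
  set s := min a (a - (C - J a + 1) / (-J' a)) with hs
  have hsa : s ≤ a := min_le_left _ _
  have key : J a - J s ≤ J' a * (a - s) := by
    have hle := (convex_Iic a).image_sub_le_mul_sub_of_deriv_le (f := J) (C := J' a)
      (fun x _ => (h1 x).continuousAt.continuousWithinAt)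
      (fun x _ => (h1 x).differentiableAt.differentiableWithinAt)
      (fun x hx => by rw [(h1 x).deriv]; exact hmono (interior_subset hx : x ∈ Set.Iic a))
    exact hle s hsa a Set.self_mem_Iic hsa
  have h3 : (C - J a + 1) / (-J' a) ≤ a - s := by linarith [min_le_right a (a - (C - J a + 1) / (-J' a))]
  rw [div_le_iff₀ (by linarith)] at h3
  linarith [hC s hsa]

/-- `J' e^{-s}` is nondecreasing, so `J - c e^s` is too; starting at `b + 1` makes `e^s ≥ 2e^b`, so
half of `c e^s` survives. -/
theorem exists_exp_le_of_deriv_le {J J' J'' : ℝ → ℝ} (h1 : ∀ s, HasDerivAt J (J' s) s)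
    (h2 : ∀ s, HasDerivAt J' (J'' s) s) (hJ : ∀ s, 0 ≤ J s) {b : ℝ} (hb : 0 < J' b)
    (h3 : ∀ s, b ≤ s → J' s ≤ J'' s) : ∃ a > 0, ∀ s, b + 1 ≤ s → a * Real.exp s ≤ J s := by
  set c := J' b * Real.exp (-b) with hc
  have hc0 : 0 < c := mul_pos hb (Real.exp_pos _)
  have hexp : ∀ s, HasDerivAt (fun s => Real.exp (-s)) (-Real.exp (-s)) s := fun s => by
    simpa using (hasDerivAt_neg s).exp
  have step1 : ∀ s, b ≤ s → c * Real.exp s ≤ J' s := by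
    intro s hs
    have := le_of_hasDerivAt_nonneg (F := fun s => J' s * Real.exp (-s))
      (fun s _ => (h2 s).mul (hexp s)) (fun s hs => by
        nlinarith [h3 s hs, Real.exp_pos (-s)]) le_rfl hs
    calc c * Real.exp s ≤ J' s * Real.exp (-s) * Real.exp s :=
          mul_le_mul_of_nonneg_right this (Real.exp_pos s).le
      _ = J' s := by rw [mul_assoc, ← Real.exp_add]; simp
  refine ⟨c / 2, by positivity, fun s hs => ?_⟩
  have step2 := le_of_hasDerivAt_nonneg (F := fun s => J s - c * Real.exp s)
      (fun s _ => (h1 s).sub ((Real.hasDerivAt_exp s).const_mul c))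
      (fun s hs => sub_nonneg.2 (step1 s hs)) le_rfl (by linarith : b ≤ s)
  have h4 : 2 * Real.exp b ≤ Real.exp s := by
    have e1 : Real.exp (b + 1) ≤ Real.exp s := Real.exp_le_exp.2 hs
    rw [Real.exp_add] at e1
    nlinarith [Real.exp_pos b, Real.add_one_le_exp (1 : ℝ)]
  nlinarith [hJ b, mul_le_mul_of_nonneg_left h4 hc0.le]

/-! ### Growth of the quadratic mean in a tract -/

theorem supportLength_le_two_pi {h : ℝ → ℝ} (hc : Continuous h) :
    supportLength h 0 (2 * Real.pi) ≤ 2 * Real.pi := by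
  have := supportLength_le_volume hc Real.two_pi_pos.le (S := Set.Icc 0 (2 * Real.pi))
    le_rfl fun t ht _ => ht
  simpa [Real.two_pi_pos.le] using this

theorem exists_tractFun_eq_zero {f : ℂ → ℂ} {U : Set ℂ} {s : ℝ}
    (h : ¬ Metric.sphere (0 : ℂ) (Real.exp s) ⊆ U) (β c K : ℝ) :
    ∃ t, tractFun f U β c K s t = 0 := by
  obtain ⟨z, hz, hzU⟩ := Set.not_subset.1 h
  obtain ⟨t, ht⟩ := exists_exp_logPoint (mem_sphere_zero_iff_norm.1 hz)
  refine ⟨t, Set.indicator_of_notMem (fun hmem => hzU ?_) _⟩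
  rw [← ht]
  exact hmem

/-- The a priori growth with `c = 0`, where there is no Laplacian error. The bound `2π` for the
support turns Carleman's inequality into both `J'' ≥ J'` and `J'' ≥ J/2`; the second, with `J`
bounded below past `|z|`, makes `J'` positive somewhere. -/
theorem IsTract.exists_exp_le_squareMean {f : ℂ → ℂ} {U : Set ℂ} {K : ℝ} (T : IsTract f U K)
    (β : ℝ) (hcircle : ∀ᶠ r : ℝ in atTop, ¬ Metric.sphere (0 : ℂ) r ⊆ U) {z : ℂ} (hzU : z ∈ U)
    (hz0 : z ≠ 0) (hz : K < Real.log ‖f z‖) :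
    ∃ a > 0, ∀ᶠ s in atTop, a * Real.exp s ≤ squareMean (tractFun f U β 0 K) s := by
  have H := T.isCylinderC2 β le_rfl
  have hw0 := tractFun_nonneg f U β 0 K
  have hlap : ∀ s t, -0 ≤ tractFunSS f U β 0 K s t + tractFunTT f U β 0 K s t := fun s t => by
    simpa using neg_le_laplacian_tractFun f U β K s t le_rfl
  have hJ'' : ∀ s, 0 ≤ squareMean'' (tractFun f U β 0 K) (tractFunS f U β 0 K)
      (tractFunSS f U β 0 K) s := fun s =>
    H.squareMean''_nonneg (hw0 s) fun t => by simpa using hlap s t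
  have hbdd : ∀ a, ∃ C, ∀ s ≤ a, squareMean (tractFun f U β 0 K) s ≤ C := by
    intro a
    obtain ⟨B, hB⟩ := (isCompact_closedBall (0 : ℂ) (Real.exp a)).exists_bound_of_continuousOn
      T.differentiable.continuous.continuousOn
    refine ⟨2 * Real.pi * |Real.log B - K| ^ 2, fun s hs =>
      squareMean_le (H.continuous_section s).1 (hw0 s) fun t =>
        tractFun_le le_rfl T.ne_zero (hB _ ?_) (abs_nonneg _) (le_abs_self _)⟩
    rw [mem_closedBall_zero_iff, norm_exp_logPoint]
    exact Real.exp_le_exp.2 hs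
  have hJ' := deriv_nonneg_of_bounded_left H.hasDerivAt_squareMean H.hasDerivAt_squareMean' hJ''
    hbdd
  obtain ⟨s₀, hs₀⟩ : ∃ s₀, Real.exp s₀ = ‖z‖ :=
    ⟨Real.log ‖z‖, Real.exp_log (norm_pos_iff.2 hz0)⟩
  have hpos : 0 < squareMean (tractFun f U β 0 K) s₀ := by
    obtain ⟨t, ht⟩ := exists_exp_logPoint hs₀.symm
    refine squareMean_pos (t := t) (H.continuous_section s₀).1 (H.periodic s₀) (ne_of_gt ?_)
    have hmem : (s₀, t) ∈ logPreimage U := by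
      change Complex.exp (logPoint (s₀, t)) ∈ U
      rwa [ht]
    rw [tractFun, Set.indicator_of_mem hmem]
    refine smoothPos_pos ?_
    simp only [tractHeight, ht]
    linarith
  obtain ⟨s₁, hs₁⟩ := eventually_atTop.1 (Real.tendsto_exp_atTop.eventually hcircle)
  have hmain : ∀ s, s₁ ≤ s →
      squareMean' (tractFun f U β 0 K) (tractFunS f U β 0 K) s ≤ squareMean'' (tractFun f U β 0 K)
        (tractFunS f U β 0 K) (tractFunSS f U β 0 K) s ∧
      squareMean (tractFun f U β 0 K) s / 2 ≤ squareMean'' (tractFun f U β 0 K)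
        (tractFunS f U β 0 K) (tractFunSS f U β 0 K) s := by
    intro s hs
    obtain ⟨t, ht⟩ := exists_tractFun_eq_zero (f := f) (hs₁ s hs) β 0 K
    have h1 := H.carleman_inequality (hw0 s) (hlap s) ht Real.two_pi_pos 
      (supportLength_le_two_pi (H.continuous_section s).1)
    have h2 := H.squareMean'_le s (1 / 2)
    have h3 : 0 ≤ ∫ t in (0 : ℝ)..(2 * Real.pi), tractFunS f U β 0 K s t ^ 2 :=
      intervalIntegral.integral_nonneg Real.two_pi_pos.le fun _ _ => sq_nonneg _
    have h4 : Real.pi / (2 * Real.pi) = 1 / 2 := by field_simp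
    rw [h4] at h1
    constructor <;> linarith
  set s₂ := max s₀ s₁
  have hb : 0 < squareMean' (tractFun f U β 0 K) (tractFunS f U β 0 K) (s₂ + 1) := by
    have h5 : ∀ s, s₂ ≤ s → squareMean (tractFun f U β 0 K) s₀ ≤ squareMean (tractFun f U β 0 K) s :=
      fun s hs => le_of_hasDerivAt_nonneg (a := s₀) (fun s _ => H.hasDerivAt_squareMean s)
        (fun s _ => hJ' s) le_rfl ((le_max_left _ _).trans hs)
    have h6 := le_of_hasDerivAt_nonneg (a := s₂)
      (fun s _ => (H.hasDerivAt_squareMean' s).fun_sub ((hasDerivAt_id' s).const_mul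
        (squareMean (tractFun f U β 0 K) s₀ / 2)))
      (fun s hs => by linarith [h5 s hs, (hmain s ((le_max_right _ _).trans hs)).2])
      le_rfl (by linarith : s₂ ≤ s₂ + 1)
    linarith [hJ' s₂]
  obtain ⟨a, ha, hle⟩ := exists_exp_le_of_deriv_le H.hasDerivAt_squareMean
    H.hasDerivAt_squareMean' (squareMean_nonneg _) hb
    fun s hs => (hmain s ((le_max_right s₀ s₁).trans (by linarith))).1
  exact ⟨a, ha, eventually_atTop.2 ⟨_, hle⟩⟩

theorem tractFun_le_add {f : ℂ → ℂ} {U : Set ℂ} {β K₁ K₂ : ℝ} (s t : ℝ) :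
    tractFun f U β 0 K₁ s t
      ≤ tractFun f U β 1 K₂ s t + (Real.exp (β * s) + (|K₂ - K₁| + 1)) := by
  have he := (Real.exp_pos (β * s)).le
  have hD := abs_nonneg (K₂ - K₁)
  have hD' := le_abs_self (K₂ - K₁)
  by_cases h : (s, t) ∈ logPreimage U
  · simp only [tractFun, Set.indicator_of_mem h]
    rcases le_total (tractHeight f β 0 K₁ (s, t)) 0 with h0 | h0
    · rw [smoothPos_of_nonpos h0]
      linarith [smoothPos_nonneg (tractHeight f β 1 K₂ (s, t))]
    · have h1 := smoothPos_le h0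
      have h2 := sub_one_le_smoothPos (tractHeight f β 1 K₂ (s, t))
      simp only [tractHeight] at h1 h2 ⊢
      linarith
  · simp only [tractFun, Set.indicator_of_notMem h]
    linarith

theorem eventually_mul_exp_le {A a b c : ℝ} (ha : 0 < a) (hbc : b < c) :
    ∀ᶠ s : ℝ in atTop, A * Real.exp (b * s) ≤ a * Real.exp (c * s) := by
  have h1 : Tendsto (fun s : ℝ => Real.exp ((c - b) * s)) atTop atTop :=
    Real.tendsto_exp_atTop.comp (tendsto_id.const_mul_atTop (sub_pos.2 hbc))
  filter_upwards [h1.eventually_ge_atTop (A / a)] with s hs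
  have h2 : Real.exp (c * s) = Real.exp ((c - b) * s) * Real.exp (b * s) := by
    rw [← Real.exp_add]; ring_nf
  rw [div_le_iff₀ ha] at hs
  rw [h2, ← mul_assoc]
  refine mul_le_mul_of_nonneg_right ?_ (Real.exp_pos _).le
  linarith

/-- By `tractFun_le_add` the two functions differ by at most `e^{βs} + D`, whose square is `o(e^s)`
since `2β < 1`. -/
theorem exists_exp_le_squareMean_of_lt_half {f : ℂ → ℂ} {U : Set ℂ} {β K₁ K₂ : ℝ}
    (T₁ : IsTract f U K₁) (T₂ : IsTract f U K₂) (hβ0 : 0 < β) (hβ : β < 1 / 2)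
    (hcircle : ∀ᶠ r : ℝ in atTop, ¬ Metric.sphere (0 : ℂ) r ⊆ U) {z : ℂ} (hzU : z ∈ U)
    (hz0 : z ≠ 0) (hz : K₁ < Real.log ‖f z‖) :
    ∃ a > 0, ∀ᶠ s in atTop, a * Real.exp s ≤ squareMean (tractFun f U β 1 K₂) s := by
  obtain ⟨a, ha, hev⟩ := T₁.exists_exp_le_squareMean β hcircle hzU hz0 hz
  have H₁ := T₁.isCylinderC2 β le_rfl
  have H₂ := T₂.isCylinderC2 β zero_le_one
  set D := |K₂ - K₁| + 1 with hD
  have hD0 : 0 < D := by positivity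
  refine ⟨a / 4, by positivity, ?_⟩
  filter_upwards [hev, eventually_ge_atTop 0, eventually_mul_exp_le (A := 4 * Real.pi * (1 + D) ^ 2)
    (a := a / 2) (b := 2 * β) (c := 1) (by positivity) (by linarith)] with s h1 hs h2
  obtain ⟨c₁, -⟩ := H₁.continuous_section s
  obtain ⟨c₂, -⟩ := H₂.continuous_section s
  set E := Real.exp (β * s) with hE
  have hE1 : 1 ≤ E := Real.one_le_exp (by positivity)
  have hEE : Real.exp (2 * β * s) = E ^ 2 := by
    rw [hE, ← Real.exp_nat_mul]; congr 1; push_cast; ring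
  have h3 : squareMean (tractFun f U β 0 K₁) s
      ≤ 2 * squareMean (tractFun f U β 1 K₂) s + 4 * Real.pi * (E + D) ^ 2 := by
    have hI : ∀ {g : ℝ → ℝ}, Continuous g → IntervalIntegrable g volume 0 (2 * Real.pi) :=
      fun hg => hg.intervalIntegrable _ _
    have h4 : squareMean (tractFun f U β 0 K₁) s ≤ ∫ t in (0 : ℝ)..(2 * Real.pi),
        (2 * tractFun f U β 1 K₂ s t ^ 2 + 2 * (E + D) ^ 2) := by
      refine intervalIntegral.integral_mono_on Real.two_pi_pos.le (hI (by fun_prop))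
        (hI (by fun_prop)) fun t _ => ?_
      have h5 := pow_le_pow_left₀ (tractFun_nonneg f U β 0 K₁ s t)
        (tractFun_le_add (f := f) (U := U) (β := β) (K₁ := K₁) (K₂ := K₂) s t) 2
      nlinarith [sq_nonneg (tractFun f U β 1 K₂ s t - (E + D))]
    rw [intervalIntegral.integral_add (hI (by fun_prop)) (hI (by fun_prop)),
      intervalIntegral.integral_const_mul, intervalIntegral.integral_const] at h4
    simp only [sub_zero, smul_eq_mul] at h4
    unfold squareMean at h4 ⊢
    linarith
  have h6 : (E + D) ^ 2 ≤ (1 + D) ^ 2 * E ^ 2 := by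
    rw [← mul_pow]
    exact pow_le_pow_left₀ (by positivity) (by nlinarith) 2
  have h7 := mul_le_mul_of_nonneg_left h6 (by positivity : 0 ≤ 4 * Real.pi)
  rw [hEE, one_mul] at h2
  linarith

/-- If the support had measure zero, Wirtinger's inequality would hold with every constant; the `y`
chosen below makes it read `C + 1 ≤ C`. -/
theorem IsCylinderC2.pos_of_supportLength_le {w ws wss wt wtt : ℝ → ℝ → ℝ}
    (H : IsCylinderC2 w ws wss wt wtt) {s m t₀ : ℝ} (ht₀ : w s t₀ = 0)
    (hle : supportLength (w s) 0 (2 * Real.pi) ≤ m) (hJ : 0 < squareMean w s) : 0 < m := by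
  by_contra! hm
  set C := ∫ t in (0 : ℝ)..(2 * Real.pi), wt s t ^ 2
  have hC : 0 ≤ C := intervalIntegral.integral_nonneg Real.two_pi_pos.le fun _ _ => sq_nonneg _
  set y := Real.sqrt ((C + 1) / squareMean w s)
  have hy : 0 < y := Real.sqrt_pos.2 (by positivity)
  have h1 := wirtinger_periodic (m := Real.pi / y) (fun t => H.deriv_t s t)
    (H.continuous_section s).2.2.2.1 Real.two_pi_pos.le (H.periodic s) (H.periodic_t s) ht₀
    (by positivity) (by linarith [div_pos Real.pi_pos hy])
  have h2 : Real.pi / (Real.pi / y) = y := by field_simp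
  rw [h2, Real.sq_sqrt (by positivity)] at h1
  change (C + 1) / squareMean w s * squareMean w s ≤ C at h1
  rw [div_mul_cancel₀ _ hJ.ne'] at h1
  linarith

/-! ### Angular measure and maximum modulus against the quadratic mean -/

theorem angularMeasure_le (V : Set ℂ) (r : ℝ) : angularMeasure V r ≤ 2 * Real.pi := by
  have : angularMeasure V r ≤ volume.real (Set.Icc 0 (2 * Real.pi)) :=
    measureReal_mono (fun t ht => ht.1) measure_Icc_lt_top.ne
  simpa [Real.two_pi_pos.le] using this

theorem measurable_angularMeasure {V : Set ℂ} (hV : MeasurableSet V) :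
    Measurable (angularMeasure V) := by
  have hS : MeasurableSet {p : ℝ × ℝ | p.2 ∈ Set.Icc 0 (2 * Real.pi) ∧
      (p.1 : ℂ) * Complex.exp (p.2 * Complex.I) ∈ V} :=
    (measurable_snd measurableSet_Icc).inter
      ((by fun_prop : Measurable fun p : ℝ × ℝ => (p.1 : ℂ) * Complex.exp (p.2 * Complex.I)) hV)
  exact (measurable_measure_prodMk_left (ν := volume) hS).ennreal_toReal

theorem measurableSet_growthSet {f : ℂ → ℂ} (hf : Continuous f) {U : Set ℂ} (hU : IsOpen U)
    (β : ℝ) : MeasurableSet (growthSet f U β) :=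
  hU.measurableSet.inter (measurableSet_le (by fun_prop) hf.norm.measurable)

theorem supportLength_tractFun_le {f : ℂ → ℂ} {U : Set ℂ} {β K : ℝ} (hK : 0 ≤ K)
    (T : IsTract f U K) (s : ℝ) :
    supportLength (tractFun f U β 1 K s) 0 (2 * Real.pi)
      ≤ angularMeasure (growthSet f U β) (Real.exp s) := by
  refine supportLength_le_volume ((T.isCylinderC2 β zero_le_one).continuous_section s).1
    Real.two_pi_pos.le (fun t ht => ht.1) fun t ht h => ⟨ht, ?_⟩
  have hmem : (s, t) ∈ logPreimage U := by
    by_contra hn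
    exact h (Set.indicator_of_notMem hn _)
  have hpos : 0 < tractHeight f β 1 K (s, t) := by
    by_contra! hn
    exact h (by rw [tractFun, Set.indicator_of_mem hmem, smoothPos_of_nonpos hn])
  rw [← exp_logPoint]
  refine ⟨hmem, ?_⟩
  rw [norm_exp_logPoint, ← Real.exp_mul, mul_comm s β]
  have h0 : 0 < ‖f (Complex.exp (logPoint (s, t)))‖ := norm_pos_iff.2 (T.ne_zero _ hmem)
  rw [← Real.le_log_iff_exp_le h0]
  simp only [tractHeight] at hpos
  linarith

theorem norm_le_maxModulus {f : ℂ → ℂ} (hf : Continuous f) {z : ℂ} {r : ℝ} (hz : ‖z‖ = r) :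
    ‖f z‖ ≤ maxModulus f r :=
  le_csSup ((isCompact_sphere (0 : ℂ) r).image hf.norm).bddAbove
    ⟨z, mem_sphere_zero_iff_norm.2 hz, rfl⟩

theorem squareMean_tractFun_le {f : ℂ → ℂ} {U : Set ℂ} {β K : ℝ} (hK : 0 ≤ K)
    (T : IsTract f U K) {s : ℝ} (hpos : 0 < squareMean (tractFun f U β 1 K) s) :
    1 < maxModulus f (Real.exp s) ∧ squareMean (tractFun f U β 1 K) s
      ≤ 2 * Real.pi * Real.log (maxModulus f (Real.exp s)) ^ 2 := by
  have c := ((T.isCylinderC2 β zero_le_one).continuous_section s).1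
  have hle : ∀ t, ‖f (Complex.exp (logPoint (s, t)))‖ ≤ maxModulus f (Real.exp s) := fun t =>
    norm_le_maxModulus T.differentiable.continuous (norm_exp_logPoint s t)
  have h0 : 0 ≤ maxModulus f (Real.exp s) := (norm_nonneg _).trans (hle 0)
  have h1 : 1 < maxModulus f (Real.exp s) := by
    -- If `M ≤ 1`, then `log M - K ≤ 0` and the function vanishes on the whole circle.
    by_contra! hn
    have := squareMean_le c (tractFun_nonneg f U β 1 K s) fun t =>
      tractFun_le zero_le_one T.ne_zero (hle t) le_rfl
        (by linarith [Real.log_nonpos h0 hn])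
    norm_num at this
    linarith
  refine ⟨h1, squareMean_le c (tractFun_nonneg f U β 1 K s) fun t =>
    tractFun_le zero_le_one T.ne_zero (hle t) (Real.log_nonneg h1.le) (by linarith)⟩

/-- The tangent line at `s` lies below `J`, and `J(s) ≥ 0` is dropped. -/
theorem mul_deriv_le_of_convex {J J' J'' : ℝ → ℝ} {a : ℝ} (h1 : ∀ s, HasDerivAt J (J' s) s)
    (h2 : ∀ s, HasDerivAt J' (J'' s) s) (hJ : ∀ s, 0 ≤ J s) (h0 : ∀ s, a ≤ s → 0 ≤ J'' s)
    {s h : ℝ} (hs : a ≤ s) (hh : 0 ≤ h) : h * J' s ≤ J (s + h) := by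
  have := le_of_hasDerivAt_nonneg (a := s)
    (fun x _ => (h1 x).fun_sub ((hasDerivAt_id' x).const_mul (J' s)))
    (fun x hx => by
      linarith [le_of_hasDerivAt_nonneg (fun s _ => h2 s) h0 hs hx])
    le_rfl (by linarith : s ≤ s + h)
  nlinarith [hJ s]

/-- The differential inequality satisfied by the quadratic mean of a tract. -/
theorem exists_squareMean_inequality {f : ℂ → ℂ} {U : Set ℂ} {β K a : ℝ} (hK : 0 ≤ K)
    (T : IsTract f U K) (hβ : β < 1 / 2)
    (hcircle : ∀ᶠ r : ℝ in atTop, ¬ Metric.sphere (0 : ℂ) r ⊆ U) (ha : 0 < a)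
    (hJ : ∀ᶠ s in atTop, a * Real.exp s ≤ squareMean (tractFun f U β 1 K) s) :
    ∃ A, ∀ᶠ s in atTop,
      0 < angularMeasure (growthSet f U β) (Real.exp s) ∧
      0 < squareMean (tractFun f U β 1 K) s ∧
      0 ≤ squareMean'' (tractFun f U β 1 K) (tractFunS f U β 1 K) (tractFunSS f U β 1 K) s ∧
      2 * (Real.pi / angularMeasure (growthSet f U β) (Real.exp s)
          - A * Real.exp (-(1 / 2 - β) * s)) *
        squareMean' (tractFun f U β 1 K) (tractFunS f U β 1 K) s ≤
      squareMean'' (tractFun f U β 1 K) (tractFunS f U β 1 K) (tractFunSS f U β 1 K) s := by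
  have H := T.isCylinderC2 β zero_le_one
  have hw0 := tractFun_nonneg f U β 1 K
  set D := β ^ 2 * (1 + 2 * Real.pi / a) with hD
  have hD0 : 0 ≤ D := by positivity
  refine ⟨2 * D, ?_⟩
  filter_upwards [hJ, Real.tendsto_exp_atTop.eventually hcircle,
    eventually_mul_exp_le (A := 4 * D) (a := 1) (b := -(1 / 2 - β)) (c := 0) one_pos
      (by linarith)] with s h1 h2 h3
  set J := squareMean (tractFun f U β 1 K) s with hJdef
  have hJ0 : 0 < J := (mul_pos ha (Real.exp_pos s)).trans_le h1
  obtain ⟨t₀, ht₀⟩ := exists_tractFun_eq_zero (f := f) h2 β 1 K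
  have hsupp := supportLength_tractFun_le (β := β) hK T s
  set m := angularMeasure (growthSet f U β) (Real.exp s) with hm
  have hm0 : 0 < m := H.pos_of_supportLength_le ht₀ hsupp hJ0
  have hlap : ∀ t, -(β ^ 2 * Real.exp (β * s))
      ≤ tractFunSS f U β 1 K s t + tractFunTT f U β 1 K s t := fun t => by
    simpa using neg_le_laplacian_tractFun f U β K s t zero_le_one
  have hcarl := H.carleman_inequality (hw0 s) hlap ht₀ hm0 hsupp
  set q := Real.pi / m with hq
  -- This lower bound lets a loss of order `ε` in `q²` be paid for by a loss `2ε` in `q`.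
  have hq1 : 1 / 2 ≤ q := by
    rw [hq, le_div_iff₀ hm0]
    linarith [angularMeasure_le (growthSet f U β) (Real.exp s)]
  set ε := D * Real.exp (-(1 / 2 - β) * s) with hε
  have hε0 : 0 ≤ ε := by positivity
  have hε1 : 4 * ε ≤ 1 := by
    simp only [zero_mul, Real.exp_zero] at h3
    linarith
  have herr : β ^ 2 * Real.exp (β * s) *
      (∫ t in (0 : ℝ)..(2 * Real.pi), tractFun f U β 1 K s t) ≤ ε * J := by
    -- The bound `J ≥ a e^s` gives `e^{s/2} ≤ e^{-s/2} J / a`, so both terms are multiples of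
    -- `e^{-s/2} J`.
    have h4 := H.integral_le s (Real.exp_pos (-s / 2))
    have h5 : 2 * Real.pi / Real.exp (-s / 2) ≤ 2 * Real.pi / a * (Real.exp (-s / 2) * J) := by
      rw [div_mul_eq_mul_div, div_le_div_iff₀ (Real.exp_pos _) ha]
      have e1 : Real.exp (-s / 2) * Real.exp (-s / 2) * Real.exp s = 1 := by
        rw [← Real.exp_add, ← Real.exp_add]; ring_nf; exact Real.exp_zero
      have e2 : a ≤ Real.exp (-s / 2) * Real.exp (-s / 2) * J := by
        calc a = Real.exp (-s / 2) * Real.exp (-s / 2) * (a * Real.exp s) := by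
              linear_combination (-a) * e1
          _ ≤ _ := mul_le_mul_of_nonneg_left h1 (by positivity)
      nlinarith [mul_le_mul_of_nonneg_left e2 Real.two_pi_pos.le]
    have h6 : ∫ t in (0 : ℝ)..(2 * Real.pi), tractFun f U β 1 K s t
        ≤ (1 + 2 * Real.pi / a) * (Real.exp (-s / 2) * J) := by
      linarith
    have e3 : Real.exp (-(1 / 2 - β) * s) = Real.exp (β * s) * Real.exp (-s / 2) := by
      rw [← Real.exp_add]; ring_nf
    calc _ ≤ β ^ 2 * Real.exp (β * s) * ((1 + 2 * Real.pi / a) * (Real.exp (-s / 2) * J)) :=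
          mul_le_mul_of_nonneg_left h6 (by positivity)
      _ = ε * J := by rw [hε, hD, e3]; ring
  -- Indeed `4qε - 4ε² ≥ 2ε - ε`, from `q ≥ 1/2` and `4ε ≤ 1`.
  have hp : (q - 2 * ε) ^ 2 ≤ q ^ 2 - ε := by nlinarith
  have hp2 := mul_le_mul_of_nonneg_right hp hJ0.le
  have hS : 0 ≤ ∫ t in (0 : ℝ)..(2 * Real.pi), tractFunS f U β 1 K s t ^ 2 :=
    intervalIntegral.integral_nonneg Real.two_pi_pos.le fun _ _ => sq_nonneg _
  have hfin := H.squareMean'_le s (q - 2 * ε)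
  have hsq := mul_nonneg (sq_nonneg (q - 2 * ε)) hJ0.le
  refine ⟨hm0, hJ0, by linarith, ?_⟩
  have hA : 2 * D * Real.exp (-(1 / 2 - β) * s) = 2 * ε := by rw [hε]; ring
  rw [hA]
  linarith

theorem IsComponentOf.exists_ne_zero_mem {f : ℂ → ℂ} (hf : Continuous f) {R : ℝ} {U : Set ℂ}
    (hU : IsComponentOf U (superlevel f R)) : ∃ z ∈ U, z ≠ 0 ∧ R < ‖f z‖ := by
  obtain ⟨z₀, hz₀, rfl⟩ := hU
  have hA : IsOpen (superlevel f R) := isOpen_lt continuous_const hf.norm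
  obtain ⟨z, hz, hz0⟩ := (dense_compl_singleton (0 : ℂ)).inter_open_nonempty _
    hA.connectedComponentIn ⟨z₀, mem_connectedComponentIn hz₀⟩
  exact ⟨z, hz, hz0,
    (connectedComponentIn_subset (superlevel f R) z₀ hz : z ∈ superlevel f R)⟩

/-! ### Integration of the differential inequality -/

theorem theorem1p2 (f : ℂ → ℂ) (hf : Differentiable ℂ f) (R : ℝ) (hR : 0 < R)
    (U : Set ℂ) (hU : IsComponentOf U (superlevel f R))
    (hcircle : ∀ᶠ r : ℝ in atTop, ¬ Metric.sphere (0 : ℂ) r ⊆ U)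
    (β : ℝ) (hβ0 : 0 < β) (hβ : β < 1 / 2)
    (ψ : ℝ → ℝ) (hψ : ψ = angularMeasure (growthSet f U β))
    (κ : ℝ) (hκ0 : 0 < κ) (hκ1 : κ < 1) :
    ∃ C r₀ : ℝ, 0 < r₀ ∧
      (∀ t : ℝ, r₀ ≤ t → 0 < ψ t) ∧
      ∀ r : ℝ, r₀ / κ ≤ r →
        1 < maxModulus f r ∧
        IntervalIntegrable (fun t => 1 / (t * ψ t)) volume r₀ (κ * r) ∧
        Real.pi * (∫ t in r₀..(κ * r), 1 / (t * ψ t)) - C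
          ≤ Real.log (Real.log (maxModulus f r)) := by
  obtain ⟨z, hzU, hz0, hzR⟩ := hU.exists_ne_zero_mem hf.continuous
  -- Two levels are used: `K₁` is below `log|f(z)|`, so that the `c = 0` function is not identically
  -- zero, while `K ≥ 0` puts the support inside `V`.
  obtain ⟨K₁, hK₁, hzK⟩ := exists_between (Real.log_lt_log hR hzR)
  have T₁ := isTract_of_isComponentOf hf hR hU hK₁
  set K := |Real.log R| + 1
  have hK : 0 ≤ K := by positivity
  have T := isTract_of_isComponentOf hf hR hU (K := K)
    (by linarith [le_abs_self (Real.log R)])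
  have H := T.isCylinderC2 β zero_le_one
  obtain ⟨a, ha, hgrow⟩ := exists_exp_le_squareMean_of_lt_half T₁ T hβ0 hβ hcircle hzU hz0 hzK
  obtain ⟨A, hA⟩ := exists_squareMean_inequality hK T hβ hcircle ha hgrow
  rw [← hψ] at hA
  have hd := H.hasDerivAt_squareMean
  have hd' := H.hasDerivAt_squareMean'
  have hc'' := H.continuous_squareMean''
  have hJnonneg := squareMean_nonneg (tractFun f U β 1 K)
  have hmax : ∀ s, 0 < squareMean (tractFun f U β 1 K) s → _ := fun s h =>
    squareMean_tractFun_le (β := β) hK T (s := s) h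
  set J := squareMean (tractFun f U β 1 K)
  set J' := squareMean' (tractFun f U β 1 K) (tractFunS f U β 1 K)
  set J'' := squareMean'' (tractFun f U β 1 K) (tractFunS f U β 1 K) (tractFunSS f U β 1 K)
  obtain ⟨s₁, hs₁⟩ := eventually_atTop.1 hA
  obtain ⟨b, hb₁, hb⟩ : ∃ b, s₁ ≤ b ∧ 0 < J' b := by
    -- Otherwise `J` would be nonincreasing on `[s₁, ∞)`, against its exponential growth.
    by_contra! hn
    obtain ⟨s, hs, h1, h2⟩ := ((eventually_ge_atTop s₁).and (hgrow.and
      ((Real.tendsto_exp_atTop.const_mul_atTop ha).eventually_gt_atTop (J s₁)))).exists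
    have := le_of_hasDerivAt_nonneg (F := fun x => -J x) (fun x _ => (hd x).neg)
      (fun x hx => neg_nonneg.2 (hn x hx)) le_rfl hs
    linarith
  have hJ'pos : ∀ s, b ≤ s → 0 < J' s := fun s hs => hb.trans_le
    (le_of_hasDerivAt_nonneg (fun x _ => hd' x) (fun x hx => (hs₁ x (hb₁.trans hx)).2.2.1) le_rfl hs)
  set δ := 1 / 2 - β
  have hδ : 0 < δ := sub_pos.2 hβ
  -- The second term is a primitive of the error, so that `E' ≥ 2π/ψ` holds with no remainder.
  set E : ℝ → ℝ := fun s => Real.log (J' s) - 2 * A / δ * Real.exp (-δ * s) with hE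
  set E' : ℝ → ℝ := fun s => J'' s / J' s + 2 * A * Real.exp (-δ * s) with hE'
  have hEd : ∀ s, b ≤ s → HasDerivAt E (E' s) s := fun s hs => by
    refine (((hd' s).log (hJ'pos s hs).ne').sub
      (((hasDerivAt_id' s).const_mul (-δ)).exp.const_mul (2 * A / δ))).congr_deriv ?_
    simp only [hE']
    field_simp
    ring
  have hEle : ∀ s, b ≤ s → 2 * (Real.pi / ψ (Real.exp s)) ≤ E' s := fun s hs => by
    have h1 := (hs₁ s (hb₁.trans hs)).2.2.2
    rw [← le_div_iff₀ (hJ'pos s hs)] at h1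
    simp only [hE']
    linarith
  have hJ'c : Continuous J' := continuous_iff_continuousAt.2 fun s => (hd' s).continuousAt
  have hE'c : ContinuousOn E' (Set.Ici b) :=
    (hc''.continuousOn.div hJ'c.continuousOn fun s hs => (hJ'pos s hs).ne').add (by fun_prop)
  have hlogb : ∀ t, Real.exp b ≤ t → 0 < t ∧ b ≤ Real.log t := fun t ht =>
    have h0 := (Real.exp_pos b).trans_le ht
    ⟨h0, (Real.le_log_iff_exp_le h0).2 ht⟩
  have hψpos : ∀ t, Real.exp b ≤ t → 0 < ψ t := fun t ht => by
    have h1 := (hs₁ _ (hb₁.trans (hlogb t ht).2)).1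
    rwa [Real.exp_log (hlogb t ht).1] at h1
  have hψm : Measurable ψ := by
    rw [hψ]
    exact measurable_angularMeasure (measurableSet_growthSet hf.continuous T.isOpen β)
  set h := -Real.log κ
  have hh : 0 < h := neg_pos.2 (Real.log_neg hκ0 hκ1)
  -- The constant is halved because `J` is compared with the square of `log M`. The absolute value
  -- is there because the sign of `A` is not known.
  refine ⟨(Real.log (2 * Real.pi) - E b - Real.log h + |2 * A / δ * Real.exp (-δ * b)|) / 2,
    Real.exp b, Real.exp_pos b, hψpos, fun r hr => ?_⟩
  rw [div_le_iff₀' hκ0] at hr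
  set S := Real.log (κ * r) with hS
  obtain ⟨hκr, hbS⟩ := hlogb _ hr
  have hr0 : 0 < r := pos_of_mul_pos_right hκr hκ0.le
  have hrS : Real.exp (S + h) = r := by
    simp only [hS, h]
    rw [Real.log_mul hκ0.ne' hr0.ne']
    ring_nf
    exact Real.exp_log hr0
  have hJS : h * J' S ≤ J (S + h) := mul_deriv_le_of_convex hd hd' hJnonneg
    (fun x hx => (hs₁ x (hb₁.trans hx)).2.2.1) hbS hh.le
  have hJSpos := (mul_pos hh (hJ'pos S hbS)).trans_le hJS
  obtain ⟨hM, hJM⟩ := hmax (S + h) hJSpos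
  rw [hrS] at hM hJM
  have hlogM := Real.log_pos hM
  have hderiv : ∀ t ∈ Set.uIcc (Real.exp b) (κ * r),
      HasDerivAt (fun t => E (Real.log t)) (E' (Real.log t) * t⁻¹) t := fun t ht => by
    rw [Set.uIcc_of_le hr] at ht
    exact (hEd _ (hlogb t ht.1).2).comp t (Real.hasDerivAt_log (hlogb t ht.1).1.ne')
  have hint : IntervalIntegrable (fun t => E' (Real.log t) * t⁻¹) volume (Real.exp b) (κ * r) := by
    apply ContinuousOn.intervalIntegrable
    rw [Set.uIcc_of_le hr]
    have hne : ∀ t ∈ Set.Icc (Real.exp b) (κ * r), t ≠ 0 := fun t ht => (hlogb t ht.1).1.ne'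
    exact (hE'c.comp (Real.continuousOn_log.mono hne) fun t ht => (hlogb t ht.1).2).mul
      (continuousOn_inv₀.mono hne)
  have hle : ∀ t ∈ Set.Icc (Real.exp b) (κ * r),
      2 * Real.pi * (1 / (t * ψ t)) ≤ E' (Real.log t) * t⁻¹ := fun t ht => by
    obtain ⟨ht0, hbt⟩ := hlogb t ht.1
    have h1 := hEle _ hbt
    rw [Real.exp_log ht0] at h1
    refine Eq.trans_le ?_ (mul_le_mul_of_nonneg_right h1 (inv_pos.2 ht0).le)
    have := hψpos t ht.1
    field_simp
  -- `ψ` is only known to be measurable, so integrability comes from domination by the continuous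
  -- function `E'(log t)/t`.
  have hint2 : IntervalIntegrable (fun t => 1 / (t * ψ t)) volume (Real.exp b) (κ * r) := by
    refine (hint.const_mul (2 * Real.pi)⁻¹).mono_fun
      (by fun_prop : Measurable fun t => 1 / (t * ψ t)).aestronglyMeasurable ?_
    refine (ae_restrict_iff' measurableSet_uIoc).2 (Eventually.of_forall fun t ht => ?_)
    rw [Set.uIoc_of_le hr] at ht
    have ht' := Set.Ioc_subset_Icc_self ht
    have h0 : 0 ≤ 1 / (t * ψ t) :=
      (one_div_pos.2 (mul_pos (hlogb t ht'.1).1 (hψpos t ht'.1))).le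
    have h1 : 1 / (t * ψ t) ≤ (2 * Real.pi)⁻¹ * (E' (Real.log t) * t⁻¹) := by
      rw [inv_mul_eq_div, le_div_iff₀' Real.two_pi_pos]
      exact hle t ht'
    change ‖1 / (t * ψ t)‖ ≤ ‖(2 * Real.pi)⁻¹ * (E' (Real.log t) * t⁻¹)‖
    rwa [Real.norm_of_nonneg h0, Real.norm_of_nonneg (h0.trans h1)]
  refine ⟨hM, hint2, ?_⟩
  have hFTC := intervalIntegral.integral_eq_sub_of_hasDerivAt hderiv hint
  have hmono := intervalIntegral.integral_mono_on hr (hint2.const_mul (2 * Real.pi)) hint hle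
  rw [hFTC, intervalIntegral.integral_const_mul, Real.log_exp] at hmono
  have hlog : Real.log h + Real.log (J' S)
      ≤ Real.log (2 * Real.pi) + 2 * Real.log (Real.log (maxModulus f r)) := by
    have h2 := Real.log_le_log (mul_pos hh (hJ'pos S hbS)) (hJS.trans hJM)
    rw [Real.log_mul hh.ne' (hJ'pos S hbS).ne', Real.log_mul Real.two_pi_pos.ne'
      (pow_ne_zero _ hlogM.ne'), Real.log_pow] at h2
    exact_mod_cast h2
  have htail : -(2 * A / δ * Real.exp (-δ * S)) ≤ |2 * A / δ * Real.exp (-δ * b)| := by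
    have h3 : Real.exp (-δ * S) ≤ Real.exp (-δ * b) := Real.exp_le_exp.2 (by nlinarith)
    refine (neg_le_abs _).trans ?_
    rw [abs_mul, abs_mul, abs_of_pos (Real.exp_pos _), abs_of_pos (Real.exp_pos _)]
    exact mul_le_mul_of_nonneg_left h3 (abs_nonneg _)
  change 2 * Real.pi * _ ≤ Real.log (J' S) - 2 * A / δ * Real.exp (-δ * S) - E b at hmono
  linarith
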